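/- **Setting.** Let $(S,\mathcal S,\mu)$ be a $\sigma$-finite measure space with the approximation-by-averaging property: for every $n\in\mathbb N=\{1,2,\dots\}$ there is a finite or countable family $\mathfrak B_n$ of pairwise disjoint measurable sets of positive finite measure such that, for every real Banach space $E$, every $r\in[1,\infty)$ and every $f\in L^r(S;E)$, the averages $f_n=\sum_{B\in\mathfrak B_n}\mathbf 1_B\,\frac1{\mu(B)}\int_B f\,d\mu$ converge to $f$ in $L^r(S;E)$ (the families $\mathfrak B_n$ do not depend on $E$, $r$, $f$). Let $(\Omega,\mathcal A,\mathbb P)$ be a probability space, $q\in[2,\infty)$ and $p\in[1,q]$. An $L^p(S)$-valued random variable $\eta$ is said to lie in $L^p(S;L^q(\Omega))$ if there is an $\mathcal S\otimes\mathcal A$-measurable $\tilde\eta:S\times\Omega\to\mathbb R$ with $\eta(\omega)=\tilde\eta(\cdot,\omega)$ in $L^p(S)$ for almost all $\omega$ such that $s\mapsto\tilde\eta(s,\cdot)$ is in the Bochner space $L^p(S;L^q(\Omega))$; its norm there is that of $s\mapsto\tilde\eta(s,\cdot)$. Let $X\in L^1(\Omega;L^p(S))$ and, for $\ell\in\mathbb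 N$, let $X_\ell\in L^q(\Omega;L^p(S))\cap L^p(S;L^q(\Omega))$; set $X_0:=0$ and $\xi_\ell:=X_\ell-X_{\ell-1}$. Let $\mathcal C_\ell\ge 0$ be the cost of generating one sample of $\xi_\ell$. Suppose there are constants $\alpha,\beta,\gamma,C_\alpha,C_\beta,C_\gamma,c_1,c_2\in(0,\infty)$, $A\in(1,\infty)$ and real numbers $N_\ell$ with $c_1A^\ell\le N_\ell\le c_2A^\ell$ such that, for all $\ell\in\mathbb N$, $$\|\mathbb E[X]-\mathbb E[X_\ell]\|_{L^p(S)}\le C_\alpha N_\ell^{-\alpha},\qquad \|X_\ell-\mathbb E[X_\ell]-(X_{\ell-1}-\mathbb E[X_{\ell-1}])\|_{L^p(S;L^q(\Omega))}\le C_\beta N_\ell^{-\beta},\qquad \mathcal C_\ell\le C_\gamma N_\ell^{\gamma}.$$ For each $\ell\in\mathbb N$ let $(\xi_{\ell,j})_{j\in\mathbb N}\subset L^q(\Omega;L^p(S))\cap L^p(S;L^q(\Omega))$ be a sequence of independent copies of the $L^p(S)$-valued random variable $\xi_\ell$ (no independence between different levels $\ell$ is assumed). **Theorem.** There is a constant $C\in(0,\infty)$,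 depending only on $q,\alpha,\beta,\gamma,C_\alpha,C_\beta,C_\gamma,A,c_1,c_2$, such that for every $\epsilon\in(0,\tfrac12]$ there are $L\in\mathbb N$ and $M_1,\dots,M_L\in\mathbb N$ for which the multilevel Monte Carlo estimator satisfies $$\Bigl\|\mathbb E[X]-\sum_{\ell=1}^L\frac1{M_\ell}\sum_{j=1}^{M_\ell}\xi_{\ell,j}\Bigr\|_{L^q(\Omega;L^p(S))}<\epsilon$$ and its cost is bounded by $$\sum_{\ell=1}^L M_\ell\,\mathcal C_\ell\;\le\; C\cdot\begin{cases}\epsilon^{-\gamma/\alpha}+\epsilon^{-2}&\text{if }\beta>\gamma/2,\\ \epsilon^{-\gamma/\alpha}+\epsilon^{-2}\,|\log_A\epsilon|^3&\text{if }\beta=\gamma/2,\\ \epsilon^{-\gamma/\alpha}+\epsilon^{-2-(\gamma-2\beta)/\alpha}&\text{if }\beta<\gamma/2.\end{cases}$$ -/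

import Mathlib

open MeasureTheory ProbabilityTheory Filter Topology
open scoped ENNReal NNReal

noncomputable section

namespace MLMC

universe u v

/-- `L^p(S)` carries its Borel σ-algebra. -/
instance lpMeasurableSpace {S : Type u} [MeasurableSpace S] {μ : Measure S} {p : ℝ≥0∞}
    [Fact (1 ≤ p)] : MeasurableSpace (Lp ℝ p μ) := borel _

instance lpBorelSpace {S : Type u} [MeasurableSpace S] {μ : Measure S} {p : ℝ≥0∞}
    [Fact (1 ≤ p)] : BorelSpace (Lp ℝ p μ) := ⟨rfl⟩

/-- The average of `f` with respect to a family `𝔅` of pairwise disjoint sets: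
`∑_{B ∈ 𝔅} 1_B • (1/μ(B)) ∫_B f dμ`, a pointwise sum with at most one nonzero term. -/
def averaging {S : Type u} [MeasurableSpace S] (μ : Measure S) {E : Type v}
    [NormedAddCommGroup E] [NormedSpace ℝ E] (𝔅 : Set (Set S)) (f : S → E) : S → E :=
  fun s => ∑' B : 𝔅, (B : Set S).indicator (fun _ => ⨍ x in (B : Set S), f x ∂μ) s

/-- The approximation-by-averaging property of a measure space: there are countable families
`𝔅 n` of pairwise disjoint measurable sets of positive finite measure such that, for all real
Banach spaces `E`, all `r ∈ [1, ∞)` and all `f ∈ L^r(S; E)`, the averages of `f` with respect to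
`𝔅 n` converge to `f` in `L^r(S; E)`. The families do not depend on `E`, `r`, `f`. -/
def ApproxByAveraging {S : Type u} [MeasurableSpace S] (μ : Measure S) : Prop :=
  ∃ 𝔅 : ℕ → Set (Set S),
    (∀ n, (𝔅 n).Countable ∧ (𝔅 n).PairwiseDisjoint id ∧
      ∀ B ∈ 𝔅 n, MeasurableSet B ∧ 0 < μ B ∧ μ B < ∞) ∧
    ∀ (E : Type v) [NormedAddCommGroup E] [NormedSpace ℝ E] [CompleteSpace E]
      (r : ℝ≥0∞), 1 ≤ r → r ≠ ∞ → ∀ f : S → E, MemLp f r μ →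
        Tendsto (fun n => eLpNorm (f - averaging μ (𝔅 n) f) r μ) atTop (𝓝 0)

variable {S : Type u} [MeasurableSpace S] {μ : Measure S}
  {Ω : Type v} [MeasurableSpace Ω] {P : Measure Ω}
  {p q : ℝ≥0∞} [Fact (1 ≤ p)] [Fact (1 ≤ q)]

/-- The `L^p(S)`-valued random variable `η` is represented by `g ∈ L^p(S; L^q(Ω))`: there is a
function `f`, measurable on the product `S × Ω`, such that `η(ω) = f(·, ω)` in `L^p(S)` for almost
all `ω` and `g(s) = f(s, ·)` in `L^q(Ω)` for almost all `s`. -/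
def IsMixedRep (η : Ω → Lp ℝ p μ) (g : Lp (Lp ℝ q P) p μ) : Prop :=
  ∃ f : S × Ω → ℝ, Measurable f ∧
    (∀ᵐ ω ∂P, ∀ᵐ s ∂μ, (η ω : S → ℝ) s = f (s, ω)) ∧
    (∀ᵐ s ∂μ, ∀ᵐ ω ∂P, (g s : Ω → ℝ) ω = f (s, ω))

/-- `η ∈ L^p(S; L^q(Ω))`. -/
def MemMixed (q : ℝ≥0∞) [Fact (1 ≤ q)] (P : Measure Ω) (η : Ω → Lp ℝ p μ) : Prop :=
  ∃ g : Lp (Lp ℝ q P) p μ, IsMixedRep η g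

/-- The norm of `η` in `L^p(S; L^q(Ω))`, with value `∞` if `η` is not in that space. -/
def mixedNorm (q : ℝ≥0∞) [Fact (1 ≤ q)] (P : Measure Ω) (η : Ω → Lp ℝ p μ) : ℝ≥0∞ :=
  ⨅ (g : Lp (Lp ℝ q P) p μ) (_ : IsMixedRep η g), ‖g‖ₑ

/-- The representing element is unique. -/
theorem IsMixedRep.unique [SigmaFinite μ] [SigmaFinite P] {η : Ω → Lp ℝ p μ}
    {g g' : Lp (Lp ℝ q P) p μ} (h : IsMixedRep η g) (h' : IsMixedRep η g') : g = g' := by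
  obtain ⟨f, hf, h1, h2⟩ := h
  obtain ⟨f', hf', h1', h2'⟩ := h'
  have hm : MeasurableSet {z : S × Ω | f z = f' z} := measurableSet_eq_fun hf hf'
  have key : ∀ᵐ ω ∂P, ∀ᵐ s ∂μ, f (s, ω) = f' (s, ω) := by
    filter_upwards [h1, h1'] with ω a b
    filter_upwards [a, b] with s c d
    rw [← c, ← d]
  have key2 : ∀ᵐ s ∂μ, ∀ᵐ ω ∂P, f (s, ω) = f' (s, ω) :=
    (Measure.ae_ae_comm (p := fun s ω => f (s, ω) = f' (s, ω)) hm).2 key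
  apply Lp.ext
  filter_upwards [h2, h2', key2] with s a b c
  apply Lp.ext
  filter_upwards [a, b, c] with ω x y z
  rw [x, y, z]

/-- `mixedNorm` is the Bochner norm of the representing element. -/
theorem IsMixedRep.mixedNorm_eq [SigmaFinite μ] [SigmaFinite P] {η : Ω → Lp ℝ p μ}
    {g : Lp (Lp ℝ q P) p μ} (h : IsMixedRep η g) : mixedNorm q P η = ‖g‖ₑ := by
  refine le_antisymm (iInf₂_le g h) (le_iInf₂ fun g' h' => ?_)
  rw [h.unique h']

/-- The level difference `ξ_ℓ = X_ℓ - X_{ℓ-1}`, used for `ℓ ≥ 1`. -/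
def levelDiff (X : ℕ → Ω → Lp ℝ p μ) (ℓ : ℕ) : Ω → Lp ℝ p μ := fun ω => X ℓ ω - X (ℓ - 1) ω

/-- The multilevel Monte Carlo estimator `∑_{ℓ=1}^L (1/M_ℓ) ∑_j ξ_{ℓ,j}`, where the inner sum is
over the first `M_ℓ` samples on level `ℓ`. -/
def estimator (ξ : ℕ → ℕ → Ω → Lp ℝ p μ) (L : ℕ) (M : ℕ → ℕ) : Ω → Lp ℝ p μ :=
  fun ω => ∑ ℓ ∈ Finset.Icc 1 L, (M ℓ : ℝ)⁻¹ • ∑ j ∈ Finset.range (M ℓ), ξ ℓ j ω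

/-- The cost of the estimator, if one sample on level `ℓ` costs `cost ℓ`. -/
def totalCost (cost : ℕ → ℝ≥0) (L : ℕ) (M : ℕ → ℕ) : ℝ :=
  ∑ ℓ ∈ Finset.Icc 1 L, (M ℓ : ℝ) * (cost ℓ : ℝ)

/-- The complexity bound as a function of the accuracy `ε`. -/
def complexityRate (A α β γ ε : ℝ) : ℝ :=
  if γ / 2 < β then ε ^ (-(γ / α)) + ε ^ (-2 : ℝ)
  else if β = γ / 2 then ε ^ (-(γ / α)) + ε ^ (-2 : ℝ) * |Real.logb A ε| ^ 3
  else ε ^ (-(γ / α)) + ε ^ (-2 - (γ - 2 * β) / α)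

end MLMC

end

universe u v

/-! Minkowski's inequality embeds `L^p(S; L^q(Ω))` into `L^q(Ω; L^p(S))` for `p ≤ q`, so the
sampling error on a level can be estimated pointwise in `s ∈ S`. There it is a sum of independent
centred real variables, for which `‖∑ Z_i‖_q² ≤ K ∑ ‖Z_i‖_q²` follows by induction on the number of
summands from a second-order Taylor bound for `|a + b|^q`. The pointwise values of independent
copies are again independent copies, since on a separable subset of `L^p(S)` a representative of
`f` can be evaluated at `s` by a function that is jointly measurable in `(s, f)`.

The sampling error is then at most a constant times `∑ M_ℓ^(-1/2) (A^ℓ)^(-β)`. Minimising the cost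
`∑ M_ℓ (A^ℓ)^γ` for a given such error costs a multiple of `T³ ε⁻²` with
`T = ∑ (A^ℓ)^((γ - 2β)/3)`. This `T` is bounded if `β > γ/2`, equal to the number of levels
`L ≲ |log_A ε|` if `β = γ/2`, and dominated by its last term otherwise. -/

namespace MLMC

section ScalarInequalities

theorem rpow_add_mul_sub_le_rpow {x y r : ℝ} (hx : 0 ≤ x) (hy : 0 ≤ y) (hr : 1 ≤ r) :
    x ^ r + r * x ^ (r - 1) * (y - x) ≤ y ^ r := by
  rcases hx.eq_or_lt with rfl | hx0
  · rcases hr.eq_or_lt with rfl | hr1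
    · simp
    · simpa [Real.zero_rpow, (zero_lt_one.trans hr1).ne', (sub_pos.2 hr1).ne'] using
        Real.rpow_nonneg hy r
  · have bernoulli := one_add_mul_self_le_rpow_one_add (s := y / x - 1)
      (by linarith [div_nonneg hy hx]) hr
    calc x ^ r + r * x ^ (r - 1) * (y - x) = x ^ r * (1 + r * (y / x - 1)) := by
          rw [Real.rpow_sub_one hx0.ne']; field_simp
      _ ≤ x ^ r * (y / x) ^ r := by
          rw [add_sub_cancel] at bernoulli
          exact mul_le_mul_of_nonneg_left bernoulli (Real.rpow_nonneg hx r)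
      _ = y ^ r := by
          rw [← Real.mul_rpow hx (div_nonneg hy hx), mul_div_cancel₀ _ hx0.ne']

theorem abs_rpow_sub_two_mul_self {q x : ℝ} (hq : q ≠ 1) (hx : 0 ≤ x) :
    |x| ^ (q - 2) * x = x ^ (q - 1) := by
  rw [abs_of_nonneg hx, ← Real.rpow_add_one' hx (by contrapose! hq; linarith)]
  ring_nf

theorem abs_rpow_sub_two_mul_sq {q : ℝ} (hq : q ≠ 0) (x : ℝ) :
    |x| ^ (q - 2) * x ^ 2 = |x| ^ q := by
  rw [← sq_abs x, ← Real.rpow_natCast, ← Real.rpow_add' (abs_nonneg x) (by simpa using hq)]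
  simp

theorem abs_rpow_sub_abs_rpow_le {q : ℝ} (hq : 1 < q) (x y : ℝ) :
    |y| ^ q - |x| ^ q ≤ q * (|y| ^ (q - 2) * y * (y - x)) := by
  have tangent := rpow_add_mul_sub_le_rpow (abs_nonneg y) (abs_nonneg x) hq.le
  have hq0 : q ≠ 0 := by linarith
  have hyy : |y| ^ (q - 2) * y ^ 2 = |y| ^ q := abs_rpow_sub_two_mul_sq hq0 y
  have habs : |y| ^ (q - 1) * |y| = |y| ^ q := by
    rw [← Real.rpow_add_one' (abs_nonneg y) (by rwa [sub_add_cancel]), sub_add_cancel]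
  have hyx : |y| ^ (q - 2) * y * x ≤ |y| ^ (q - 1) * |x| := by
    refine (le_abs_self _).trans_eq ?_
    rw [abs_mul, abs_mul, abs_of_nonneg (by positivity),
      ← abs_rpow_sub_two_mul_self hq.ne' (abs_nonneg y), abs_abs]
  calc |y| ^ q - |x| ^ q ≤ q * (|y| ^ (q - 1) * |y| - |y| ^ (q - 1) * |x|) := by linarith
    _ ≤ q * (|y| ^ (q - 2) * y ^ 2 - |y| ^ (q - 2) * y * x) := by
        rw [habs, hyy]; gcongr
    _ = q * (|y| ^ (q - 2) * y * (y - x)) := by ring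

theorem abs_rpow_mul_sub_le_of_le {q x y B : ℝ} (hq : 2 ≤ q) (hxy : x ≤ y) (hx : |x| ≤ B)
    (hy : |y| ≤ B) :
    |y| ^ (q - 2) * y - |x| ^ (q - 2) * x ≤ (q - 1) * B ^ (q - 2) * (y - x) := by
  have hpow {z : ℝ} (hz : |z| ≤ B) : |z| ^ (q - 2) ≤ B ^ (q - 2) :=
    Real.rpow_le_rpow (abs_nonneg z) hz (by linarith)
  have of_nonneg {u v : ℝ} (hu : 0 ≤ u) (huv : u ≤ v) (hv : |v| ≤ B) :
      |v| ^ (q - 2) * v - |u| ^ (q - 2) * u ≤ (q - 1) * B ^ (q - 2) * (v - u) := by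
    rw [abs_rpow_sub_two_mul_self (by linarith) hu,
      abs_rpow_sub_two_mul_self (by linarith) (hu.trans huv)]
    have tangent :=
      rpow_add_mul_sub_le_rpow (hu.trans huv) hu (show 1 ≤ q - 1 by linarith)
    rw [show q - 1 - 1 = q - 2 by ring] at tangent
    have hvB := hpow hv
    rw [abs_of_nonneg (hu.trans huv)] at hvB
    linarith [mul_le_mul_of_nonneg_left hvB
      (mul_nonneg (show 0 ≤ q - 1 by linarith) (sub_nonneg.2 huv))]
  rcases le_total 0 x with hx0 | hx0
  · exact of_nonneg hx0 hxy hy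
  rcases le_total 0 y with hy0 | hy0
  · have hB : 0 ≤ B ^ (q - 2) := Real.rpow_nonneg ((abs_nonneg x).trans hx) _
    linarith [mul_le_mul_of_nonneg_right (hpow hy) hy0,
      mul_le_mul_of_nonneg_right (hpow hx) (neg_nonneg.2 hx0),
      mul_nonneg (mul_nonneg (show 0 ≤ q - 2 by linarith) hB) (sub_nonneg.2 hxy)]
  · have reflected := of_nonneg (neg_nonneg.2 hy0) (neg_le_neg hxy) (by rwa [abs_neg])
    rw [abs_neg, abs_neg] at reflected
    linarith

theorem abs_rpow_mul_sub_mul_sub_le {q x y B : ℝ} (hq : 2 ≤ q) (hx : |x| ≤ B) (hy : |y| ≤ B) :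
    (|y| ^ (q - 2) * y - |x| ^ (q - 2) * x) * (y - x) ≤ (q - 1) * B ^ (q - 2) * (y - x) ^ 2 := by
  rcases le_total x y with hxy | hxy
  · linarith [mul_le_mul_of_nonneg_right (abs_rpow_mul_sub_le_of_le hq hxy hx hy)
      (sub_nonneg.2 hxy)]
  · linarith [mul_le_mul_of_nonneg_right (abs_rpow_mul_sub_le_of_le hq hxy hy hx)
      (sub_nonneg.2 hxy)]

theorem add_rpow_le_two_rpow_mul {x y r : ℝ} (hx : 0 ≤ x) (hy : 0 ≤ y) (hr : 0 ≤ r) :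
    (x + y) ^ r ≤ 2 ^ r * (x ^ r + y ^ r) := by
  calc (x + y) ^ r ≤ (2 * max x y) ^ r :=
        Real.rpow_le_rpow (add_nonneg hx hy)
          (by linarith [le_max_left x y, le_max_right x y]) hr
    _ = 2 ^ r * max (x ^ r) (y ^ r) := by
        rw [Real.mul_rpow zero_le_two (hx.trans (le_max_left x y)),
          (Real.monotoneOn_rpow_Ici_of_exponent_nonneg hr).map_max hx hy]
    _ ≤ 2 ^ r * (x ^ r + y ^ r) := by
        gcongr
        exact max_le_add_of_nonneg (Real.rpow_nonneg hx r) (Real.rpow_nonneg hy r)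

theorem abs_add_rpow_le {q : ℝ} (hq : 2 ≤ q) (a b : ℝ) :
    |a + b| ^ q ≤ |a| ^ q + q * (|a| ^ (q - 2) * a * b)
      + q * (q - 1) * 2 ^ (q - 2) * (|a| ^ (q - 2) * b ^ 2 + |b| ^ q) := by
  have first_order := abs_rpow_sub_abs_rpow_le (by linarith : 1 < q) a (a + b)
  have second_order := abs_rpow_mul_sub_mul_sub_le (x := a) (y := a + b) (B := |a| + |b|) hq
    (by linarith [abs_nonneg b]) (abs_add_le a b)
  have hB := add_rpow_le_two_rpow_mul (abs_nonneg a) (abs_nonneg b) (sub_nonneg.2 hq)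
  rw [add_sub_cancel_left] at first_order second_order
  have hb : |b| ^ (q - 2) * b ^ 2 = |b| ^ q := abs_rpow_sub_two_mul_sq (by linarith) b
  have hq1 : 0 ≤ q - 1 := by linarith
  calc |a + b| ^ q
      ≤ |a| ^ q + q * (|a| ^ (q - 2) * a * b)
        + q * ((|a + b| ^ (q - 2) * (a + b) - |a| ^ (q - 2) * a) * b) := by linarith
    _ ≤ |a| ^ q + q * (|a| ^ (q - 2) * a * b)
        + q * ((q - 1) * (2 ^ (q - 2) * (|a| ^ (q - 2) + |b| ^ (q - 2))) * b ^ 2) := by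
        have hq0 : 0 ≤ q := by linarith
        refine add_le_add_right (mul_le_mul_of_nonneg_left (second_order.trans ?_) hq0) _
        gcongr
    _ = _ := by
        rw [← hb]; ring

theorem rpow_add_half_mul_le {x y K b : ℝ} (hx : 0 ≤ x) (hy : 0 ≤ y) (hK : 1 ≤ K) (hb : 1 ≤ b) :
    x ^ b + K / 2 * (x ^ (b - 1) * y + y ^ b) ≤ (x + K * y) ^ b := by
  have hKy : 0 ≤ K * y := mul_nonneg (by linarith) hy
  have superadditive : x ^ b + K * y ^ b ≤ (x + K * y) ^ b := by
    refine le_trans ?_ (Real.add_rpow_le_rpow_add hx hKy hb)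
    rw [Real.mul_rpow (by linarith) hy]
    gcongr
    simpa using Real.rpow_le_rpow_of_exponent_le hK hb
  have tangent := rpow_add_mul_sub_le_rpow hx (add_nonneg hx hKy) hb
  rw [add_sub_cancel_left] at tangent
  linarith [mul_nonneg (sub_nonneg.2 hb) (mul_nonneg (Real.rpow_nonneg hx (b - 1)) hKy)]

end ScalarInequalities

section Moments

variable {Ω : Type*} [MeasurableSpace Ω] {P : Measure Ω}

theorem integral_abs_rpow_le_iff {f : Ω → ℝ} {r τ : ℝ} (hf : MemLp f (ENNReal.ofReal r) P)
    (hr : 0 < r) (hτ : 0 ≤ τ) :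
    ∫ ω, |f ω| ^ r ∂P ≤ τ ^ r ↔ eLpNorm f (ENNReal.ofReal r) P ≤ ENNReal.ofReal τ := by
  rw [hf.eLpNorm_eq_integral_rpow_norm (by simpa using hr) ENNReal.ofReal_ne_top,
    ENNReal.ofReal_le_ofReal_iff hτ, ENNReal.toReal_ofReal hr.le]
  exact (Real.rpow_inv_le_iff_of_pos (integral_nonneg fun ω => by positivity) hτ hr).symm

variable [IsProbabilityMeasure P]

theorem integrable_abs_rpow {f : Ω → ℝ} {q r : ℝ} (hf : MemLp f (ENNReal.ofReal q) P)
    (hr : 0 ≤ r) (hrq : r ≤ q) : Integrable (fun ω => |f ω| ^ r) P := by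
  simpa [ENNReal.toReal_ofReal hr] using
    (hf.mono_exponent (ENNReal.ofReal_le_ofReal hrq)).integrable_norm_rpow'

theorem integrable_abs_rpow_mul_self {f : Ω → ℝ} {q : ℝ} (hf : MemLp f (ENNReal.ofReal q) P)
    (hq : 2 ≤ q) : Integrable (fun ω => |f ω| ^ (q - 2) * f ω) P := by
  have hcont : Continuous fun x : ℝ => |x| ^ (q - 2) * x :=
    (continuous_abs.rpow_const fun _ => Or.inr (by linarith)).mul continuous_id
  refine (integrable_abs_rpow hf (r := q - 1) (by linarith) (by linarith)).mono'
    (hcont.comp_aestronglyMeasurable hf.1) (ae_of_all _ fun ω => le_of_eq ?_)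
  rw [norm_mul, Real.norm_of_nonneg (by positivity), Real.norm_eq_abs,
    ← abs_rpow_sub_two_mul_self (by linarith) (abs_nonneg (f ω)), abs_abs]

theorem integral_abs_rpow_le {f : Ω → ℝ} {q r τ : ℝ} (hf : MemLp f (ENNReal.ofReal q) P)
    (hr : 0 ≤ r) (hrq : r ≤ q) (hτ : 0 ≤ τ)
    (hfτ : eLpNorm f (ENNReal.ofReal q) P ≤ ENNReal.ofReal τ) : ∫ ω, |f ω| ^ r ∂P ≤ τ ^ r := by
  rcases hr.eq_or_lt with rfl | hr0
  · simp
  have hle := ENNReal.ofReal_le_ofReal hrq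
  exact (integral_abs_rpow_le_iff (hf.mono_exponent hle) hr0 hτ).2
    ((eLpNorm_le_eLpNorm_of_exponent_le hle hf.1).trans hfτ)

theorem integral_abs_add_rpow_le {q : ℝ} (hq : 2 ≤ q) {S Z : Ω → ℝ}
    (hS : MemLp S (ENNReal.ofReal q) P) (hZ : MemLp Z (ENNReal.ofReal q) P)
    (hind : IndepFun S Z P) (hZ0 : ∫ ω, Z ω ∂P = 0) :
    ∫ ω, |S ω + Z ω| ^ q ∂P ≤ ∫ ω, |S ω| ^ q ∂P + q * (q - 1) * 2 ^ (q - 2) *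
      ((∫ ω, |S ω| ^ (q - 2) ∂P) * (∫ ω, Z ω ^ 2 ∂P) + ∫ ω, |Z ω| ^ q ∂P) := by
  have hcont : Continuous fun x : ℝ => |x| ^ (q - 2) :=
    continuous_abs.rpow_const fun _ => Or.inr (by linarith)
  have hq0 : 0 ≤ q := by linarith
  have hSq := integrable_abs_rpow hS hq0 le_rfl
  have hZq := integrable_abs_rpow hZ hq0 le_rfl
  have hS1 := integrable_abs_rpow_mul_self hS hq
  have hS2 := integrable_abs_rpow hS (r := q - 2) (by linarith) (by linarith)
  have hZ1 : Integrable Z P := hZ.integrable (by simpa using hq.trans' one_le_two)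
  have hZ2 : Integrable (fun ω => Z ω ^ 2) P := by
    simpa using integrable_abs_rpow hZ zero_le_two hq
  have hind1 : IndepFun (fun ω => |S ω| ^ (q - 2) * S ω) Z P :=
    hind.comp (hcont.mul continuous_id).measurable measurable_id
  have hind2 : IndepFun (fun ω => |S ω| ^ (q - 2)) (fun ω => Z ω ^ 2) P :=
    hind.comp hcont.measurable (continuous_pow 2).measurable
  have first_order_int : Integrable (fun ω => |S ω| ^ (q - 2) * S ω * Z ω) P :=
    hind1.integrable_mul hS1 hZ1
  have second_order_int : Integrable (fun ω => |S ω| ^ (q - 2) * Z ω ^ 2) P :=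
    hind2.integrable_mul hS2 hZ2
  have first_order : ∫ ω, |S ω| ^ (q - 2) * S ω * Z ω ∂P = 0 := by
    rw [hind1.integral_fun_mul_eq_mul_integral hS1.1 hZ.1, hZ0, mul_zero]
  have second_order : ∫ ω, |S ω| ^ (q - 2) * Z ω ^ 2 ∂P
      = (∫ ω, |S ω| ^ (q - 2) ∂P) * ∫ ω, Z ω ^ 2 ∂P :=
    hind2.integral_fun_mul_eq_mul_integral hS2.1 hZ2.1
  have main_int : Integrable (fun ω => |S ω| ^ q + q * (|S ω| ^ (q - 2) * S ω * Z ω)) P :=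
    hSq.add (first_order_int.const_mul q)
  have remainder_int := (second_order_int.add hZq).const_mul (q * (q - 1) * 2 ^ (q - 2))
  refine (integral_mono (integrable_abs_rpow (hS.add hZ) hq0 le_rfl)
    (main_int.add remainder_int) fun ω => abs_add_rpow_le hq (S ω) (Z ω)).trans_eq ?_
  rw [integral_add' main_int remainder_int, integral_add hSq (first_order_int.const_mul q),
    integral_const_mul, integral_const_mul, integral_add' second_order_int hZq, first_order,
    second_order, mul_zero, add_zero]

/-- The constant in the Marcinkiewicz–Zygmund inequality `eLpNorm_sum_sq_le` with exponent `q`. -/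
noncomputable def marcinkiewiczConst (q : ℝ) : ℝ := q * (q - 1) * 2 ^ (q - 1)

theorem one_le_marcinkiewiczConst {q : ℝ} (hq : 2 ≤ q) : 1 ≤ marcinkiewiczConst q := by
  have hpow : (1 : ℝ) ≤ 2 ^ (q - 1) := Real.one_le_rpow one_le_two (by linarith)
  have hmul : 1 ≤ q * (q - 1) := by nlinarith
  exact one_le_mul_of_one_le_of_one_le hmul hpow

theorem marcinkiewiczConst_half (q : ℝ) :
    marcinkiewiczConst q / 2 = q * (q - 1) * 2 ^ (q - 2) := by
  rw [marcinkiewiczConst, show q - 2 = q - 1 - 1 by ring, Real.rpow_sub_one two_ne_zero (q - 1)]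
  ring

theorem eLpNorm_add_le_sqrt {q τ σ : ℝ} (hq : 2 ≤ q) (hτ : 0 ≤ τ) (hσ : 0 ≤ σ) {S Z : Ω → ℝ}
    (hS : MemLp S (ENNReal.ofReal q) P) (hZ : MemLp Z (ENNReal.ofReal q) P)
    (hind : IndepFun S Z P) (hZ0 : ∫ ω, Z ω ∂P = 0)
    (hSτ : eLpNorm S (ENNReal.ofReal q) P ≤ ENNReal.ofReal τ)
    (hZσ : eLpNorm Z (ENNReal.ofReal q) P ≤ ENNReal.ofReal σ) :
    eLpNorm (S + Z) (ENNReal.ofReal q) P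
      ≤ ENNReal.ofReal (√(τ ^ 2 + marcinkiewiczConst q * σ ^ 2)) := by
  have hq0 : 0 < q := by linarith
  have hK := one_le_marcinkiewiczConst hq
  have sq_rpow {t : ℝ} (ht : 0 ≤ t) (r : ℝ) : t ^ r = (t ^ 2) ^ (r / 2) := by
    rw [← Real.rpow_natCast_mul ht]; congr 1; push_cast; ring
  refine (integral_abs_rpow_le_iff (hS.add hZ) hq0 (Real.sqrt_nonneg _)).1 ?_
  calc ∫ ω, |S ω + Z ω| ^ q ∂P
      ≤ ∫ ω, |S ω| ^ q ∂P + marcinkiewiczConst q / 2 *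
          ((∫ ω, |S ω| ^ (q - 2) ∂P) * (∫ ω, Z ω ^ 2 ∂P) + ∫ ω, |Z ω| ^ q ∂P) := by
        rw [marcinkiewiczConst_half]
        exact integral_abs_add_rpow_le hq hS hZ hind hZ0
    _ ≤ τ ^ q + marcinkiewiczConst q / 2 * (τ ^ (q - 2) * σ ^ 2 + σ ^ q) := by
        gcongr
        · exact integral_abs_rpow_le hS hq0.le le_rfl hτ hSτ
        · exact integral_abs_rpow_le hS (by linarith) (by linarith) hτ hSτ
        · simpa using integral_abs_rpow_le hZ zero_le_two hq hσ hZσ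
        · exact integral_abs_rpow_le hZ hq0.le le_rfl hσ hZσ
    _ ≤ (τ ^ 2 + marcinkiewiczConst q * σ ^ 2) ^ (q / 2) := by
        rw [sq_rpow hτ q, sq_rpow hτ (q - 2), sq_rpow hσ q,
          show (q - 2) / 2 = q / 2 - 1 by ring]
        exact rpow_add_half_mul_le (sq_nonneg τ) (sq_nonneg σ) hK (by linarith)
    _ = √(τ ^ 2 + marcinkiewiczConst q * σ ^ 2) ^ q := by
        rw [sq_rpow (Real.sqrt_nonneg _) q, Real.sq_sqrt (by positivity)]

theorem eLpNorm_add_sq_le {q : ℝ≥0∞} (hq : 2 ≤ q) (hq_top : q ≠ ∞) {S Z : Ω → ℝ}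
    (hS : AEStronglyMeasurable S P) (hZ : AEStronglyMeasurable Z P) (hind : IndepFun S Z P)
    (hZ0 : ∫ ω, Z ω ∂P = 0) :
    eLpNorm (S + Z) q P ^ 2 ≤ eLpNorm S q P ^ 2
      + ENNReal.ofReal (marcinkiewiczConst q.toReal) * eLpNorm Z q P ^ 2 := by
  have hq2 : 2 ≤ q.toReal := by simpa using ENNReal.toReal_mono hq_top hq
  have hK := one_le_marcinkiewiczConst hq2
  rcases eq_or_ne (eLpNorm S q P) ∞ with hS_top | hS_top
  · simp [hS_top]
  rcases eq_or_ne (eLpNorm Z q P) ∞ with hZ_top | hZ_top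
  · simp [hZ_top, ENNReal.mul_top, zero_lt_one.trans_le hK]
  rw [← ENNReal.ofReal_toReal hS_top, ← ENNReal.ofReal_toReal hZ_top,
    ← ENNReal.ofReal_pow ENNReal.toReal_nonneg, ← ENNReal.ofReal_pow ENNReal.toReal_nonneg,
    ← ENNReal.ofReal_mul (by positivity), ← ENNReal.ofReal_add (by positivity) (by positivity),
    ← Real.sq_sqrt (x := _ + _) (by positivity), ENNReal.ofReal_pow (Real.sqrt_nonneg _)]
  refine pow_le_pow_left' ?_ 2
  rw [← ENNReal.ofReal_toReal hq_top] at hS_top hZ_top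
  simpa only [ENNReal.ofReal_toReal hq_top] using
    eLpNorm_add_le_sqrt hq2 ENNReal.toReal_nonneg ENNReal.toReal_nonneg ⟨hS, hS_top.lt_top⟩
      ⟨hZ, hZ_top.lt_top⟩ hind hZ0 (ENNReal.ofReal_toReal hS_top).ge
      (ENNReal.ofReal_toReal hZ_top).ge

theorem eLpNorm_sum_sq_le {ι : Type*} {q : ℝ≥0∞} (hq : 2 ≤ q) (hq_top : q ≠ ∞) {Z : ι → Ω → ℝ}
    (hZ : ∀ i, AEStronglyMeasurable (Z i) P) (hind : iIndepFun Z P)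
    (hZ0 : ∀ i, ∫ ω, Z i ω ∂P = 0) (s : Finset ι) :
    eLpNorm (∑ i ∈ s, Z i) q P ^ 2
      ≤ ENNReal.ofReal (marcinkiewiczConst q.toReal) * ∑ i ∈ s, eLpNorm (Z i) q P ^ 2 := by
  classical
  induction s using Finset.induction_on with
  | empty => simp
  | insert i s hi ih =>
    rw [Finset.sum_insert hi, Finset.sum_insert hi, add_comm, mul_add, add_comm (_ * _)]
    refine (eLpNorm_add_sq_le hq hq_top (s.aestronglyMeasurable_sum fun j _ => hZ j) (hZ i)
      (hind.indepFun_finsetSum_of_notMem₀ (fun j => (hZ j).aemeasurable) hi) (hZ0 i)).trans ?_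
    gcongr

theorem eLpNorm_sum_range_le {q : ℝ≥0∞} (hq : 2 ≤ q) (hq_top : q ≠ ∞) {Y : Ω → ℝ} {Z : ℕ → Ω → ℝ}
    (hY : AEStronglyMeasurable Y P) (hY0 : ∫ ω, Y ω ∂P = 0) (hind : iIndepFun Z P)
    (hident : ∀ j, IdentDistrib (Z j) Y P P) (n : ℕ) :
    eLpNorm (∑ j ∈ Finset.range n, Z j) q P
      ≤ ENNReal.ofReal √(marcinkiewiczConst q.toReal * n) * eLpNorm Y q P := by
  have h := eLpNorm_sum_sq_le hq hq_top
    (fun j => (hident j).symm.aestronglyMeasurable_snd hY) hind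
    (fun j => (hident j).integral_eq.trans hY0) (Finset.range n)
  have hK := zero_le_one.trans (one_le_marcinkiewiczConst (q := q.toReal)
    (by simpa using ENNReal.toReal_mono hq_top hq))
  refine (ENNReal.pow_right_strictMono two_ne_zero).le_iff_le.1 (h.trans_eq ?_)
  rw [Finset.sum_congr rfl fun j _ => by rw [(hident j).eLpNorm_eq], Finset.sum_const,
    Finset.card_range, nsmul_eq_mul, mul_pow, ← ENNReal.ofReal_pow (Real.sqrt_nonneg _),
    Real.sq_sqrt (by positivity), ENNReal.ofReal_mul hK, ENNReal.ofReal_natCast, mul_assoc]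

end Moments

section Minkowski

variable {S Ω : Type*} [MeasurableSpace S] {μ : Measure S} [SFinite μ] [MeasurableSpace Ω]
  {P : Measure Ω}

-- The proof divides by a power of `∫ φ ^ r`, so `φ` has to stand for a truncation of the inner
-- integral.
theorem lintegral_rpow_le_of_le_lintegral [SFinite P] {r : ℝ} (hr : 1 < r) {G : S × Ω → ℝ≥0∞}
    (hG : Measurable G) {φ : Ω → ℝ≥0∞} (hφ : Measurable φ)
    (hφG : ∀ ω, φ ω ≤ ∫⁻ s, G (s, ω) ∂μ) (hφ_top : ∫⁻ ω, φ ω ^ r ∂P ≠ ∞) :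
    ∫⁻ ω, φ ω ^ r ∂P ≤ (∫⁻ s, (∫⁻ ω, G (s, ω) ^ r ∂P) ^ (1 / r) ∂μ) ^ r := by
  have hr0 : 0 < r := by linarith
  have hr1 : r - 1 ≠ 0 := by linarith
  set I := ∫⁻ ω, φ ω ^ r ∂P with hI
  rcases eq_or_ne I 0 with hI0 | hI0
  · simp [hI0]
  have holder (s : S) : ∫⁻ ω, φ ω ^ (r - 1) * G (s, ω) ∂P
      ≤ I ^ (1 - 1 / r) * (∫⁻ ω, G (s, ω) ^ r ∂P) ^ (1 / r) := by
    refine (ENNReal.lintegral_mul_le_Lp_mul_Lq P (Real.HolderConjugate.conjExponent hr).symm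
      (hφ.pow_const _).aemeasurable
      (hG.comp measurable_prodMk_left).aemeasurable).trans_eq ?_
    simp only [← ENNReal.rpow_mul, Real.conjExponent, mul_div_cancel₀ _ hr1, ← hI]
    congr 2
    field_simp
  have absorb : I ≤ I ^ (1 - 1 / r) * ∫⁻ s, (∫⁻ ω, G (s, ω) ^ r ∂P) ^ (1 / r) ∂μ := by
    calc I = ∫⁻ ω, φ ω ^ (r - 1) * φ ω ∂P := by
          refine lintegral_congr fun ω => ?_
          conv_rhs => rw [← ENNReal.rpow_one (φ ω), ← ENNReal.rpow_mul, one_mul]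
          rw [← ENNReal.rpow_add_of_nonneg _ _ (by linarith) zero_le_one, sub_add_cancel]
      _ ≤ ∫⁻ ω, ∫⁻ s, φ ω ^ (r - 1) * G (s, ω) ∂μ ∂P := by
          gcongr with ω
          rw [lintegral_const_mul _ (by fun_prop)]
          exact mul_le_mul_right (hφG ω) _
      _ = ∫⁻ s, ∫⁻ ω, φ ω ^ (r - 1) * G (s, ω) ∂P ∂μ :=
          lintegral_lintegral_swap (by fun_prop)
      _ ≤ ∫⁻ s, I ^ (1 - 1 / r) * (∫⁻ ω, G (s, ω) ^ r ∂P) ^ (1 / r) ∂μ := lintegral_mono holder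
      _ = _ := lintegral_const_mul _ ((hG.pow_const r).lintegral_prod_right'.pow_const _)
  have split : I = I ^ (1 - 1 / r) * I ^ (1 / r) := by
    rw [← ENNReal.rpow_add _ _ hI0 hφ_top, sub_add_cancel, ENNReal.rpow_one]
  nth_rw 1 [split] at absorb
  rw [← ENNReal.rpow_inv_le_iff hr0, ← one_div]
  exact (ENNReal.mul_le_mul_iff_right (by simp [ENNReal.rpow_eq_zero_iff, hI0, hφ_top])
    (by simp [ENNReal.rpow_eq_top_iff, hI0, hφ_top])).1 absorb

theorem lintegral_rpow_lintegral_le [SigmaFinite P] {r : ℝ} (hr : 1 ≤ r) {G : S × Ω → ℝ≥0∞}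
    (hG : Measurable G) :
    ∫⁻ ω, (∫⁻ s, G (s, ω) ∂μ) ^ r ∂P
      ≤ (∫⁻ s, (∫⁻ ω, G (s, ω) ^ r ∂P) ^ (1 / r) ∂μ) ^ r := by
  rcases hr.eq_or_lt with rfl | hr1
  · simpa using (lintegral_lintegral_swap (f := fun ω s => G (s, ω)) (by fun_prop)).le
  have hr0 : 0 ≤ r := by linarith
  have hH : Measurable fun ω => ∫⁻ s, G (s, ω) ∂μ := hG.lintegral_prod_left'
  refine lintegral_le_of_forall_fin_meas_le _ fun T _ hT_top => ?_
  have truncation (n : ℕ) : ∫⁻ ω in T, min (∫⁻ s, G (s, ω) ∂μ) n ^ r ∂P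
      ≤ (∫⁻ s, (∫⁻ ω, G (s, ω) ^ r ∂P) ^ (1 / r) ∂μ) ^ r := by
    refine (lintegral_rpow_le_of_le_lintegral hr1 hG (hH.min measurable_const)
      (fun ω => min_le_left _ _) (ne_top_of_le_ne_top ?_ (lintegral_mono fun ω =>
        ENNReal.rpow_le_rpow (min_le_right _ _) hr0))).trans ?_
    · simp [ENNReal.mul_eq_top, hT_top, hr0]
    · gcongr
      exact Measure.restrict_le_self
  refine le_of_tendsto' (lintegral_tendsto_of_tendsto_of_monotone
    (fun n => ((hH.min measurable_const).pow_const r).aemeasurable)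
    (ae_of_all _ fun ω m n hmn => ?_) (ae_of_all _ fun ω => ?_)) truncation
  · dsimp only
    gcongr
  · simpa using (tendsto_const_nhds.min ENNReal.tendsto_nat_nhds_top).ennrpow_const r

theorem eLpNorm_eLpNorm_swap_le [SigmaFinite P] {p q : ℝ≥0∞} (hpq : p ≤ q) (hq_top : q ≠ ∞)
    {F : S × Ω → ℝ} (hF : Measurable F) :
    eLpNorm (fun ω => eLpNorm (fun s => F (s, ω)) p μ) q P
      ≤ eLpNorm (fun s => eLpNorm (fun ω => F (s, ω)) q P) p μ := by
  rcases eq_or_ne p 0 with rfl | hp0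
  · simp
  have hp_top : p ≠ ∞ := ne_top_of_le_ne_top hq_top hpq
  have hq0 : q ≠ 0 := (hp0.bot_lt.trans_le hpq).ne'
  have hp := ENNReal.toReal_pos hp0 hp_top
  have hq := ENNReal.toReal_pos hq0 hq_top
  have minkowski := lintegral_rpow_lintegral_le (μ := μ) (P := P)
    ((one_le_div hp).2 (ENNReal.toReal_mono hq_top hpq)) (hF.enorm.pow_const p.toReal)
  simp only [eLpNorm_eq_lintegral_rpow_enorm_toReal hp0 hp_top,
    eLpNorm_eq_lintegral_rpow_enorm_toReal hq0 hq_top, enorm_eq_self, ← ENNReal.rpow_mul]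
  rw [one_div q.toReal, ENNReal.rpow_inv_le_iff hq, ← ENNReal.rpow_mul]
  simp only [← ENNReal.rpow_mul] at minkowski
  convert minkowski using 2 <;> field_simp

end Minkowski

section JointVersions

variable {S : Type*} [MeasurableSpace S] {μ : Measure S} {Ω : Type*} [MeasurableSpace Ω]
  {P : Measure Ω} {p q : ℝ≥0∞}

/-- `F` is a jointly measurable version of the `L^p(S)`-valued random variable `η`; this is the
function `η̃` in the description of `L^p(S; L^q(Ω))`. -/
structure IsJointVersion (P : Measure Ω) (η : Ω → Lp ℝ p μ) (F : S × Ω → ℝ) : Prop where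
  measurable : Measurable F
  ae_eq : ∀ᵐ ω ∂P, ∀ᵐ s ∂μ, η ω s = F (s, ω)

namespace IsJointVersion

variable {η : Ω → Lp ℝ p μ} {F : S × Ω → ℝ}

theorem finsetSum {ι : Type*} (t : Finset ι) {ξ : ι → Ω → Lp ℝ p μ} {Ξ : ι → S × Ω → ℝ}
    (h : ∀ i ∈ t, IsJointVersion P (ξ i) (Ξ i)) :
    IsJointVersion P (∑ i ∈ t, ξ i) (∑ i ∈ t, Ξ i) where
  measurable := by
    simpa only [Finset.sum_fn] using t.measurable_sum fun i hi => (h i hi).measurable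
  ae_eq := by
    filter_upwards [(ae_ball_iff t.countable_toSet).2 fun i hi => (h i hi).ae_eq] with ω hω
    filter_upwards [(ae_ball_iff t.countable_toSet).2 hω, Lp.coeFn_finsetSum t fun i => ξ i ω]
      with s hs hsum
    rw [Finset.sum_apply, hsum, Finset.sum_apply, Finset.sum_apply]
    exact Finset.sum_congr rfl hs

theorem ae_ae_eq [SFinite μ] [SFinite P] {F' : S × Ω → ℝ} (h : IsJointVersion P η F)
    (h' : IsJointVersion P η F') : ∀ᵐ s ∂μ, ∀ᵐ ω ∂P, F (s, ω) = F' (s, ω) := by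
  rw [Measure.ae_ae_comm (p := fun s ω => F (s, ω) = F' (s, ω))
    (measurableSet_eq_fun h.measurable h'.measurable)]
  filter_upwards [h.ae_eq, h'.ae_eq] with ω hω hω'
  filter_upwards [hω, hω'] with s hs hs'
  rw [← hs, hs']

theorem eLpNorm_le [SigmaFinite P] [SFinite μ] [Fact (1 ≤ p)] (h : IsJointVersion P η F)
    (hpq : p ≤ q) (hq_top : q ≠ ∞) :
    eLpNorm η q P ≤ eLpNorm (fun s => eLpNorm (fun ω => F (s, ω)) q P) p μ := by
  have henorm : ∀ᵐ ω ∂P, ‖η ω‖ₑ = ‖eLpNorm (fun s => F (s, ω)) p μ‖ₑ := by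
    filter_upwards [h.ae_eq] with ω hω
    rw [Lp.enorm_def, enorm_eq_self, eLpNorm_congr_ae hω]
  rw [eLpNorm_congr_enorm_ae henorm]
  exact eLpNorm_eLpNorm_swap_le hpq hq_top h.measurable

theorem eLpNorm_eLpNorm_le_mixedNorm [SFinite μ] [SFinite P] [Fact (1 ≤ p)] [Fact (1 ≤ q)]
    (h : IsJointVersion P η F) :
    eLpNorm (fun s => eLpNorm (fun ω => F (s, ω)) q P) p μ ≤ mixedNorm q P η := by
  refine le_iInf₂ fun g ⟨f, hf, hηf, hgf⟩ => ?_
  rw [Lp.enorm_def]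
  refine (eLpNorm_congr_enorm_ae ?_).le
  filter_upwards [h.ae_ae_eq ⟨hf, hηf⟩, hgf] with s hFf hgf
  rw [enorm_eq_self, Lp.enorm_def]
  refine eLpNorm_congr_ae ?_
  filter_upwards [hFf, hgf] with ω hFω hgω
  rw [hFω, hgω]

end IsJointVersion

theorem exists_clm_eq_setIntegral [hp : Fact (1 ≤ p)] {B : Set S} (hB : MeasurableSet B)
    (hμB : μ B ≠ ∞) : ∃ Λ : Lp ℝ p μ →L[ℝ] ℝ, ∀ x, Λ x = ∫ s in B, x s ∂μ := by
  have : p.conjExponent.HolderConjugate p := .symm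
  have : Fact (1 ≤ p.conjExponent) := ⟨by simp [ENNReal.conjExponent]⟩
  refine ⟨(ContinuousLinearMap.mul ℝ ℝ).lpPairing μ p.conjExponent p
    (indicatorConstLp p.conjExponent hB hμB 1), fun x => ?_⟩
  rw [ContinuousLinearMap.lpPairing_eq_integral, ← integral_indicator hB]
  refine integral_congr_ae ?_
  filter_upwards [indicatorConstLp_coeFn (p := p.conjExponent) (hs := hB) (hμs := hμB)
    (c := (1 : ℝ))] with s hs
  rw [hs]
  by_cases h : s ∈ B <;> simp [h]

namespace IsJointVersion

variable [hp : Fact (1 ≤ p)] {η : Ω → Lp ℝ p μ} {F : S × Ω → ℝ}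

theorem integrable_prod_restrict [SFinite μ] [SFinite P] (h : IsJointVersion P η F)
    (hη : Integrable η P) {B : Set S} (hB : MeasurableSet B) (hμB : μ B ≠ ∞) :
    Integrable F ((μ.restrict B).prod P) := by
  obtain ⟨Λ, hΛ⟩ := exists_clm_eq_setIntegral (p := p) hB hμB
  rw [integrable_prod_iff' h.measurable.aestronglyMeasurable]
  constructor
  · filter_upwards [h.ae_eq] with ω hω
    exact (integrableOn_Lp_of_measure_ne_top (η ω) hp.out hμB).congr (ae_restrict_of_ae hω)
  · refine Integrable.mono' (hη.norm.const_mul ‖Λ‖) (h.measurable.norm.comp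
      measurable_swap).stronglyMeasurable.integral_prod_right'.aestronglyMeasurable ?_
    filter_upwards [h.ae_eq] with ω hω
    have habs : ∫ s in B, ‖F (s, ω)‖ ∂μ = Λ |η ω| := by
      rw [hΛ]
      refine integral_congr_ae (ae_restrict_of_ae ?_)
      filter_upwards [hω, Lp.coeFn_abs (η ω)] with s hs hs_abs
      rw [hs_abs, hs, Real.norm_eq_abs]
    rw [habs]
    simpa only [norm_abs_eq_norm] using Λ.le_opNorm |η ω|

theorem ae_integral_eq [SigmaFinite μ] [SigmaFinite P] (h : IsJointVersion P η F)
    (hη : Integrable η P) : ∀ᵐ s ∂μ, ∫ ω, F (s, ω) ∂P = (∫ ω, η ω ∂P : Lp ℝ p μ) s := by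
  refine ae_eq_of_forall_setIntegral_eq_of_sigmaFinite
    (fun B hB hμB => (h.integrable_prod_restrict hη hB hμB.ne).integral_prod_left)
    (fun B _ hμB => integrableOn_Lp_of_measure_ne_top _ hp.out hμB.ne) fun B hB hμB => ?_
  obtain ⟨Λ, hΛ⟩ := exists_clm_eq_setIntegral (p := p) hB hμB.ne
  rw [← hΛ, ← Λ.integral_comp_comm hη, integral_integral_swap (f := fun s ω => F (s, ω))
    (h.integrable_prod_restrict hη hB hμB.ne)]
  refine integral_congr_ae ?_
  filter_upwards [h.ae_eq] with ω hω
  rw [hΛ]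
  exact integral_congr_ae (ae_restrict_of_ae (hω.mono fun s => Eq.symm))

end IsJointVersion

end JointVersions

section Evaluation

theorem exists_measurable_index_dist_lt {E : Type*} [PseudoMetricSpace E] [MeasurableSpace E]
    [OpensMeasurableSpace E] [Nonempty E] {T : Set E} (hT : TopologicalSpace.IsSeparable T) :
    ∃ (d : ℕ → E) (k : ℕ → E → ℕ), (∀ n, Measurable (k n)) ∧
      ∀ x ∈ T, ∀ n, dist x (d (k n x)) < (1 / 2 : ℝ) ^ n := by
  classical
  obtain ⟨c, hc, hTc⟩ := hT
  obtain ⟨d, hd⟩ := (hc.insert (Classical.arbitrary E)).exists_eq_range (Set.insert_nonempty _ _)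
  have hTd : T ⊆ closure (Set.range d) :=
    hTc.trans (closure_mono (hd ▸ Set.subset_insert _ c))
  have hex : ∀ n x, ∃ k, dist x (d k) < (1 / 2 : ℝ) ^ n ∨ x ∉ closure (Set.range d) := by
    intro n x
    by_cases hx : x ∈ closure (Set.range d)
    · obtain ⟨_, ⟨k, rfl⟩, hk⟩ := Metric.mem_closure_iff.1 hx ((1 / 2 : ℝ) ^ n) (by positivity)
      exact ⟨k, Or.inl hk⟩
    · exact ⟨0, Or.inr hx⟩
  refine ⟨d, fun n x => Nat.find (hex n x), fun n => measurable_find _ fun k => ?_,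
    fun x hx n => (Nat.find_spec (hex n x)).resolve_right (not_not.2 (hTd hx))⟩
  exact (isOpen_lt (continuous_id.dist continuous_const) continuous_const).measurableSet.union
    isClosed_closure.measurableSet.compl

variable {S : Type*} [MeasurableSpace S] {μ : Measure S} {p : ℝ≥0∞} [hp : Fact (1 ≤ p)]

theorem ae_tendsto_of_dist_lt_half_pow {x : Lp ℝ p μ} {y : ℕ → Lp ℝ p μ}
    (hxy : ∀ n, dist x (y n) < (1 / 2 : ℝ) ^ n) :
    ∀ᵐ s ∂μ, Tendsto (fun n => y n s) atTop (𝓝 (x s)) := by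
  have hnorm : ∀ n, eLpNorm (y n - x : Lp ℝ p μ) p μ ≤ ENNReal.ofReal ((1 / 2) ^ n) := fun n => by
    rw [← Lp.enorm_def, ← ofReal_norm, ← dist_eq_norm, dist_comm]
    exact ENNReal.ofReal_le_ofReal (hxy n).le
  have hsummable : ∀ᵐ s ∂μ, Summable fun n => ‖(y n - x : Lp ℝ p μ) s‖ := by
    refine summable_norm_of_tsum_eLpNorm_ne_top hp.out (fun n => Lp.aestronglyMeasurable _)
      (ne_top_of_le_ne_top ?_ (ENNReal.tsum_le_tsum hnorm))
    rw [← ENNReal.ofReal_tsum_of_nonneg (fun n => by positivity) summable_geometric_two]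
    exact ENNReal.ofReal_ne_top
  filter_upwards [hsummable, ae_all_iff.2 fun n => Lp.coeFn_sub (y n) x] with s hs hsub
  have hdiff := tendsto_zero_iff_norm_tendsto_zero.2 hs.tendsto_atTop_zero
  simp only [hsub, Pi.sub_apply] at hdiff
  simpa only [sub_add_cancel, zero_add] using hdiff.add_const (x s)

theorem exists_measurable_eval {T : Set (Lp ℝ p μ)} (hT : TopologicalSpace.IsSeparable T) :
    ∃ e : S × Lp ℝ p μ → ℝ, Measurable e ∧ ∀ x ∈ T, ∀ᵐ s ∂μ, x s = e (s, x) := by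
  obtain ⟨d, k, hk, hclose⟩ := exists_measurable_index_dist_lt hT
  have hd : Measurable fun z : ℕ × S => d z.1 z.2 :=
    measurable_from_prod_countable_right fun n => (Lp.stronglyMeasurable (d n)).measurable
  refine ⟨fun z => limsup (fun n => d (k n z.2) z.1) atTop, Measurable.limsup fun n =>
    hd.comp (((hk n).comp measurable_snd).prodMk measurable_fst), fun x hx => ?_⟩
  filter_upwards [ae_tendsto_of_dist_lt_half_pow (hclose x hx)] with s hs
  exact hs.limsup_eq.symm

variable {Ω : Type*} [MeasurableSpace Ω] {P : Measure Ω}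

theorem exists_isJointVersion_copies {η : Ω → Lp ℝ p μ} {ξ : ℕ → Ω → Lp ℝ p μ}
    (hη : AEStronglyMeasurable η P) (hξ : ∀ j, AEStronglyMeasurable (ξ j) P)
    (hind : iIndepFun ξ P) (hident : ∀ j, IdentDistrib (ξ j) η P P) :
    ∃ (F : S × Ω → ℝ) (Ξ : ℕ → S × Ω → ℝ), IsJointVersion P η F ∧
      (∀ j, IsJointVersion P (ξ j) (Ξ j)) ∧
      ∀ s, iIndepFun (fun j ω => Ξ j (s, ω)) P ∧
        ∀ j, IdentDistrib (fun ω => Ξ j (s, ω)) (fun ω => F (s, ω)) P P := by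
  obtain ⟨T, hT, hηT⟩ := hη.isSeparable_ae_range
  choose T' hT' hξT' using fun j => (hξ j).isSeparable_ae_range
  obtain ⟨e, he, heval⟩ :=
    exists_measurable_eval (hT.union (TopologicalSpace.IsSeparable.iUnion hT'))
  have hversion : ∀ {ζ : Ω → Lp ℝ p μ} (hζ : AEStronglyMeasurable ζ P),
      (∀ᵐ ω ∂P, ζ ω ∈ T ∪ ⋃ j, T' j) → IsJointVersion P ζ fun z => e (z.1, hζ.mk ζ z.2) := by
    refine fun hζ hmem => ⟨he.comp (measurable_fst.prodMk
      (hζ.stronglyMeasurable_mk.measurable.comp measurable_snd)), ?_⟩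
    filter_upwards [hmem, hζ.ae_eq_mk] with ω hω heq
    simpa only [← heq] using heval _ hω
  have he_section : ∀ s, Measurable fun x => e (s, x) := fun s => he.comp measurable_prodMk_left
  refine ⟨_, fun j => _, hversion hη (hηT.mono fun ω => Or.inl), fun j =>
    hversion (hξ j) ((hξT' j).mono fun ω hω => Or.inr (Set.mem_iUnion.2 ⟨j, hω⟩)), fun s =>
    ⟨(hind.congr fun j => (hξ j).ae_eq_mk).comp (fun _ x => e (s, x)) fun _ => he_section s,
      fun j => ?_⟩⟩
  exact (((IdentDistrib.of_ae_eq (hξ j).aemeasurable (hξ j).ae_eq_mk).symm.trans (hident j)).trans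
    (IdentDistrib.of_ae_eq hη.aemeasurable hη.ae_eq_mk)).comp (he_section s)

end Evaluation

section MonteCarlo

variable {S : Type*} [MeasurableSpace S] {μ : Measure S} [SigmaFinite μ]
  {Ω : Type*} [MeasurableSpace Ω] {P : Measure Ω} [IsProbabilityMeasure P]
  {p q : ℝ≥0∞} [Fact (1 ≤ p)] [Fact (1 ≤ q)]

theorem eLpNorm_sum_range_le_mixedNorm (hpq : p ≤ q) (hq : 2 ≤ q) (hq_top : q ≠ ∞)
    {η : Ω → Lp ℝ p μ} (hη : Integrable η P) (hη0 : ∫ ω, η ω ∂P = 0) {ξ : ℕ → Ω → Lp ℝ p μ}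
    (hind : iIndepFun ξ P) (hident : ∀ j, IdentDistrib (ξ j) η P P) (n : ℕ) :
    eLpNorm (∑ j ∈ Finset.range n, ξ j) q P
      ≤ ENNReal.ofReal √(marcinkiewiczConst q.toReal * n) * mixedNorm q P η := by
  obtain ⟨F, Ξ, hF, hΞ, hcopies⟩ := exists_isJointVersion_copies hη.aestronglyMeasurable
    (fun j => (hident j).symm.aestronglyMeasurable_snd hη.aestronglyMeasurable) hind hident
  have hmean : ∀ᵐ s ∂μ, ∫ ω, F (s, ω) ∂P = 0 := by
    filter_upwards [hF.ae_integral_eq hη, Lp.coeFn_zero ℝ p μ] with s hs hzero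
    rw [hs, hη0, hzero, Pi.zero_apply]
  have hpointwise : ∀ᵐ s ∂μ, eLpNorm (fun ω => (∑ j ∈ Finset.range n, Ξ j) (s, ω)) q P
      ≤ ENNReal.ofReal √(marcinkiewiczConst q.toReal * n) * eLpNorm (fun ω => F (s, ω)) q P := by
    filter_upwards [hmean] with s hs
    simpa only [Finset.sum_fn, Finset.sum_apply, Function.comp_def] using
      eLpNorm_sum_range_le hq hq_top
        (hF.measurable.comp measurable_prodMk_left).aestronglyMeasurable hs (hcopies s).1
        (hcopies s).2 n
  calc eLpNorm (∑ j ∈ Finset.range n, ξ j) q P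
      ≤ eLpNorm (fun s => eLpNorm (fun ω => (∑ j ∈ Finset.range n, Ξ j) (s, ω)) q P) p μ :=
        (IsJointVersion.finsetSum _ fun j _ => hΞ j).eLpNorm_le hpq hq_top
    _ ≤ ENNReal.ofReal √(marcinkiewiczConst q.toReal * n)
          * eLpNorm (fun s => eLpNorm (fun ω => F (s, ω)) q P) p μ :=
        eLpNorm_le_mul_eLpNorm_of_ae_le_mul' (c := Real.toNNReal _) hpointwise p
    _ ≤ _ := by gcongr; exact hF.eLpNorm_eLpNorm_le_mixedNorm

theorem eLpNorm_integral_sub_average_le (hpq : p ≤ q) (hq : 2 ≤ q) (hq_top : q ≠ ∞)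
    {η : Ω → Lp ℝ p μ} (hη : Integrable η P) {ξ : ℕ → Ω → Lp ℝ p μ}
    (hind : iIndepFun ξ P) (hident : ∀ j, IdentDistrib (ξ j) η P P) {n : ℕ} (hn : n ≠ 0) :
    eLpNorm (fun ω => (∫ ω', η ω' ∂P) - (n : ℝ)⁻¹ • ∑ j ∈ Finset.range n, ξ j ω) q P
      ≤ ENNReal.ofReal √(marcinkiewiczConst q.toReal / n)
        * mixedNorm q P (fun ω => η ω - ∫ ω', η ω' ∂P) := by
  set m := ∫ ω, η ω ∂P
  have hcentre : Measurable fun x : Lp ℝ p μ => x - m := (continuous_sub_right m).measurable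
  have hcentred := eLpNorm_sum_range_le_mixedNorm hpq hq hq_top (hη.sub (integrable_const m))
    (by simp [integral_sub hη (integrable_const m), m])
    (hind.comp (fun _ x => x - m) fun _ => hcentre) (fun j => (hident j).comp hcentre) n
  have herror : (fun ω => m - (n : ℝ)⁻¹ • ∑ j ∈ Finset.range n, ξ j ω)
      = (-(n : ℝ)⁻¹) • ∑ j ∈ Finset.range n, (fun x => x - m) ∘ ξ j := by
    ext1 ω
    simp only [Pi.smul_apply, Finset.sum_apply, Function.comp_apply, Finset.sum_sub_distrib,
      Finset.sum_const, Finset.card_range]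
    rw [← Nat.cast_smul_eq_nsmul ℝ, smul_sub, smul_smul, neg_mul,
      inv_mul_cancel₀ (Nat.cast_ne_zero.2 hn), neg_smul, neg_smul, one_smul]
    abel
  have hconst : (n : ℝ)⁻¹ * √(marcinkiewiczConst q.toReal * n)
      = √(marcinkiewiczConst q.toReal / n) := by
    rw [← Real.sqrt_sq (inv_nonneg.2 n.cast_nonneg), ← Real.sqrt_mul (sq_nonneg _)]
    congr 1
    field_simp
  rw [herror, eLpNorm_const_smul, ← hconst, ENNReal.ofReal_mul (by positivity), mul_assoc,
    enorm_neg, Real.enorm_of_nonneg (by positivity)]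
  exact mul_le_mul_right hcentred _

end MonteCarlo

section Multilevel

variable {S : Type*} [MeasurableSpace S] {μ : Measure S} {Ω : Type*} {p q : ℝ≥0∞}

theorem sub_estimator_eq (x : Lp ℝ p μ) {m : ℕ → Lp ℝ p μ} (hm : m 0 = 0)
    (ξ : ℕ → ℕ → Ω → Lp ℝ p μ) (L : ℕ) (M : ℕ → ℕ) (ω : Ω) :
    x - estimator ξ L M ω = (x - m L) + ∑ ℓ ∈ Finset.Icc 1 L,
      (m ℓ - m (ℓ - 1) - (M ℓ : ℝ)⁻¹ • ∑ j ∈ Finset.range (M ℓ), ξ ℓ j ω) := by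
  have htelescope : ∑ ℓ ∈ Finset.Icc 1 L, (m ℓ - m (ℓ - 1)) = m L := by
    rw [← Finset.Ico_add_one_right_eq_Icc, Finset.sum_Ico_eq_sum_range]
    simp only [add_comm 1, Nat.add_sub_cancel, Finset.sum_range_sub, hm, sub_zero]
  rw [Finset.sum_sub_distrib, htelescope, estimator]
  abel

variable [Fact (1 ≤ p)] [MeasurableSpace Ω] {P : Measure Ω}

theorem integral_levelDiff {X : ℕ → Ω → Lp ℝ p μ} (hX : ∀ ℓ, Integrable (X ℓ) P) (ℓ : ℕ) :
    ∫ ω, levelDiff X ℓ ω ∂P = ∫ ω, X ℓ ω ∂P - ∫ ω, X (ℓ - 1) ω ∂P :=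
  integral_sub (hX ℓ) (hX (ℓ - 1))

theorem eLpNorm_sub_estimator_le [SigmaFinite μ] [IsProbabilityMeasure P] [Fact (1 ≤ q)]
    (hpq : p ≤ q) (hq : 2 ≤ q) (hq_top : q ≠ ∞) (x : Lp ℝ p μ) {X : ℕ → Ω → Lp ℝ p μ}
    (hX0 : X 0 = 0) (hX : ∀ ℓ, Integrable (X ℓ) P) {ξ : ℕ → ℕ → Ω → Lp ℝ p μ}
    (hind : ∀ ℓ, 1 ≤ ℓ → iIndepFun (ξ ℓ) P)
    (hident : ∀ ℓ, 1 ≤ ℓ → ∀ j, IdentDistrib (ξ ℓ j) (levelDiff X ℓ) P P)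
    (L : ℕ) {M : ℕ → ℕ} (hM : ∀ ℓ, M ℓ ≠ 0) :
    eLpNorm (fun ω => x - estimator ξ L M ω) q P ≤ ‖x - ∫ ω, X L ω ∂P‖ₑ
      + ∑ ℓ ∈ Finset.Icc 1 L, ENNReal.ofReal √(marcinkiewiczConst q.toReal / M ℓ)
        * mixedNorm q P (fun ω => (X ℓ ω - ∫ ω', X ℓ ω' ∂P)
          - (X (ℓ - 1) ω - ∫ ω', X (ℓ - 1) ω' ∂P)) := by
  have hq1 : 1 ≤ q := Fact.out
  have hdiff : ∀ ℓ, Integrable (levelDiff X ℓ) P := fun ℓ => (hX ℓ).sub (hX (ℓ - 1))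
  set V : ℕ → Ω → Lp ℝ p μ := fun ℓ ω => ∫ ω', X ℓ ω' ∂P - ∫ ω', X (ℓ - 1) ω' ∂P
    - (M ℓ : ℝ)⁻¹ • ∑ j ∈ Finset.range (M ℓ), ξ ℓ j ω
  have hVmeas : ∀ ℓ ∈ Finset.Icc 1 L, AEStronglyMeasurable (V ℓ) P := fun ℓ hℓ =>
    aestronglyMeasurable_const.sub <| AEStronglyMeasurable.fun_const_smul
      (Finset.aestronglyMeasurable_fun_sum _ fun j _ =>
        (hident ℓ (Finset.mem_Icc.1 hℓ).1 j).symm.aestronglyMeasurable_snd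
          (hdiff ℓ).aestronglyMeasurable) _
  have hVnorm : ∀ ℓ ∈ Finset.Icc 1 L, eLpNorm (V ℓ) q P
      ≤ ENNReal.ofReal √(marcinkiewiczConst q.toReal / M ℓ) * mixedNorm q P (fun ω =>
        (X ℓ ω - ∫ ω', X ℓ ω' ∂P) - (X (ℓ - 1) ω - ∫ ω', X (ℓ - 1) ω' ∂P)) := by
    intro ℓ hℓ
    have h := eLpNorm_integral_sub_average_le hpq hq hq_top (hdiff ℓ)
      (hind ℓ (Finset.mem_Icc.1 hℓ).1) (hident ℓ (Finset.mem_Icc.1 hℓ).1) (hM ℓ)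
    rw [integral_levelDiff hX] at h
    simpa only [levelDiff, sub_sub_sub_comm (X ℓ _)] using h
  have hdecomp : (fun ω => x - estimator ξ L M ω)
      = (fun _ => x - ∫ ω, X L ω ∂P) + ∑ ℓ ∈ Finset.Icc 1 L, V ℓ := by
    ext1 ω
    rw [sub_estimator_eq x (m := fun ℓ => ∫ ω, X ℓ ω ∂P) (by simp [hX0]), Pi.add_apply,
      Finset.sum_apply]
  rw [hdecomp]
  refine (eLpNorm_add_le aestronglyMeasurable_const
    (Finset.aestronglyMeasurable_sum _ hVmeas) hq1).trans (add_le_add ?_ ?_)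
  · rw [eLpNorm_const _ (zero_lt_one.trans_le hq1).ne' (IsProbabilityMeasure.ne_zero P),
      measure_univ, ENNReal.one_rpow, mul_one]
  · exact (eLpNorm_sum_le hVmeas hq1).trans (Finset.sum_le_sum hVnorm)

theorem eLpNorm_sub_estimator_le_ofReal [SigmaFinite μ] [IsProbabilityMeasure P] [Fact (1 ≤ q)]
    (hpq : p ≤ q) (hq : 2 ≤ q) (hq_top : q ≠ ∞) {x : Lp ℝ p μ} {X : ℕ → Ω → Lp ℝ p μ}
    (hX0 : X 0 = 0) (hX : ∀ ℓ, Integrable (X ℓ) P) {ξ : ℕ → ℕ → Ω → Lp ℝ p μ}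
    (hind : ∀ ℓ, 1 ≤ ℓ → iIndepFun (ξ ℓ) P)
    (hident : ∀ ℓ, 1 ≤ ℓ → ∀ j, IdentDistrib (ξ ℓ j) (levelDiff X ℓ) P P)
    {L : ℕ} {M : ℕ → ℕ} (hM : ∀ ℓ, M ℓ ≠ 0) {a : ℝ} (ha : ‖x - ∫ ω, X L ω ∂P‖ ≤ a) {b : ℕ → ℝ}
    (hb0 : ∀ ℓ, 0 ≤ b ℓ) (hb : ∀ ℓ, 1 ≤ ℓ → mixedNorm q P (fun ω => (X ℓ ω - ∫ ω', X ℓ ω' ∂P)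
      - (X (ℓ - 1) ω - ∫ ω', X (ℓ - 1) ω' ∂P)) ≤ ENNReal.ofReal (b ℓ)) :
    eLpNorm (fun ω => x - estimator ξ L M ω) q P ≤ ENNReal.ofReal
      (a + ∑ ℓ ∈ Finset.Icc 1 L, √(marcinkiewiczConst q.toReal / M ℓ) * b ℓ) := by
  have hterm : ∀ ℓ ∈ Finset.Icc 1 L, 0 ≤ √(marcinkiewiczConst q.toReal / M ℓ) * b ℓ :=
    fun ℓ _ => mul_nonneg (Real.sqrt_nonneg _) (hb0 ℓ)
  refine (eLpNorm_sub_estimator_le hpq hq hq_top x hX0 hX hind hident L hM).trans ?_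
  rw [ENNReal.ofReal_add ((norm_nonneg _).trans ha) (Finset.sum_nonneg hterm),
    ENNReal.ofReal_sum_of_nonneg hterm, ← ofReal_norm]
  refine add_le_add (ENNReal.ofReal_le_ofReal ha) (Finset.sum_le_sum fun ℓ hℓ => ?_)
  rw [ENNReal.ofReal_mul (Real.sqrt_nonneg _)]
  exact mul_le_mul_right (hb ℓ (Finset.mem_Icc.1 hℓ).1) _

end Multilevel

section LevelSums

/-- The sum `∑_{ℓ=1}^L (A^ℓ)^θ` of powers of the level sizes. -/
noncomputable def levelSum (A θ : ℝ) (L : ℕ) : ℝ := ∑ ℓ ∈ Finset.Icc 1 L, (A ^ ℓ) ^ θ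

variable {A θ : ℝ}

theorem levelSum_nonneg (hA : 0 ≤ A) (θ : ℝ) (L : ℕ) : 0 ≤ levelSum A θ L :=
  Finset.sum_nonneg fun _ _ => by positivity

theorem levelSum_pos (hA : 0 < A) (θ : ℝ) {L : ℕ} (hL : 1 ≤ L) : 0 < levelSum A θ L :=
  Finset.sum_pos (fun _ _ => by positivity) ⟨1, Finset.mem_Icc.2 ⟨le_rfl, hL⟩⟩

theorem levelSum_zero (A : ℝ) (L : ℕ) : levelSum A 0 L = L := by simp [levelSum]

theorem levelSum_eq_geom_sum (hA : 0 ≤ A) (θ : ℝ) (L : ℕ) :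
    levelSum A θ L = ∑ ℓ ∈ Finset.Ico 1 (L + 1), (A ^ θ) ^ ℓ := by
  rw [Finset.Ico_add_one_right_eq_Icc]
  exact Finset.sum_congr rfl fun ℓ _ => (Real.rpow_pow_comm hA θ ℓ).symm

theorem levelSum_le_of_pos (hA : 1 < A) (hθ : 0 < θ) (L : ℕ) :
    levelSum A θ L ≤ A ^ θ / (A ^ θ - 1) * (A ^ L) ^ θ := by
  have hratio : 0 < A ^ θ - 1 := sub_pos.2 (Real.one_lt_rpow hA hθ)
  rw [levelSum_eq_geom_sum (by positivity), geom_sum_Ico (sub_ne_zero.1 hratio.ne') (by omega),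
    ← Real.rpow_pow_comm (by positivity), div_mul_eq_mul_div, pow_one, pow_succ']
  gcongr
  exact sub_le_self _ (by positivity)

theorem levelSum_le_of_neg (hA : 1 < A) (hθ : θ < 0) (L : ℕ) :
    levelSum A θ L ≤ A ^ θ / (1 - A ^ θ) := by
  rw [levelSum_eq_geom_sum (by positivity)]
  simpa only [pow_one] using geom_sum_Ico_le_of_lt_one (m := 1) (n := L + 1)
    (by positivity : 0 ≤ A ^ θ) (Real.rpow_lt_one_of_one_lt_of_neg hA hθ)

end LevelSums

section LevelChoice

variable {A α D ε : ℝ}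

theorem exists_level (hA : 1 < A) (hα : 0 < α) (a : ℝ) : ∃ D : ℝ, 1 ≤ D ∧
    ∀ ε : ℝ, 0 < ε → ε ≤ 1 → ∃ L : ℕ, 1 ≤ L ∧ a * (A ^ L) ^ (-α) < ε / 2 ∧
      (A ^ L) ^ α ≤ D / ε := by
  have hB : 1 < A ^ α := Real.one_lt_rpow hA hα
  refine ⟨max 1 (2 * a) * A ^ α, one_le_mul_of_one_le_of_one_le (le_max_left _ _) hB.le,
    fun ε hε hε1 => ?_⟩
  obtain ⟨n, hle, hlt⟩ := exists_nat_pow_near (x := max 1 (2 * a) / ε) (y := A ^ α)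
    ((one_le_div hε).2 (hε1.trans (le_max_left _ _))) hB
  refine ⟨n + 1, by omega, ?_, ?_⟩
  · have hbias : 2 * a < (A ^ α) ^ (n + 1) * ε :=
      (le_max_right _ _).trans_lt ((div_lt_iff₀ hε).1 hlt)
    rw [Real.rpow_neg (by positivity), ← Real.rpow_pow_comm (by positivity), ← div_eq_mul_inv,
      div_lt_iff₀ (by positivity)]
    linarith
  · rw [← Real.rpow_pow_comm (by positivity), pow_succ, mul_div_right_comm]
    gcongr

theorem rpow_le_of_rpow_le_div (hα : 0 < α) (hD : 0 ≤ D) (hε : 0 < ε) {κ x : ℝ} (hκ : 0 ≤ κ)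
    (hx : 0 ≤ x) (h : x ^ α ≤ D / ε) : x ^ κ ≤ D ^ (κ / α) * ε ^ (-(κ / α)) := by
  calc x ^ κ = (x ^ α) ^ (κ / α) := by rw [← Real.rpow_mul hx, mul_div_cancel₀ _ hα.ne']
    _ ≤ (D / ε) ^ (κ / α) := by gcongr
    _ = D ^ (κ / α) * ε ^ (-(κ / α)) := by
      rw [Real.div_rpow hD hε.le, Real.rpow_neg hε.le, div_eq_mul_inv]

theorem exists_level_le_mul_abs_logb (hA : 1 < A) (hα : 0 < α) (hD : 1 ≤ D) :
    ∃ H : ℝ, 0 < H ∧ ∀ ε : ℝ, 0 < ε → ε ≤ 1 / 2 → ∀ L : ℕ, (A ^ L) ^ α ≤ D / ε →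
      (L : ℝ) ≤ H * |Real.logb A ε| := by
  have hlog2 : 0 < Real.logb A 2 := Real.logb_pos hA one_lt_two
  have hlogD : 0 ≤ Real.logb A D := Real.logb_nonneg hA hD
  refine ⟨(Real.logb A D / Real.logb A 2 + 1) / α, by positivity, fun ε hε hε2 L hL => ?_⟩
  have hlogε : Real.logb A 2 ≤ |Real.logb A ε| := by
    refine le_trans ?_ (neg_le_abs _)
    rw [← Real.logb_inv]
    exact Real.logb_le_logb_of_le hA two_pos ((le_inv_comm₀ two_pos hε).2 (by linarith))
  have hLlog : α * L ≤ Real.logb A D - Real.logb A ε := by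
    rw [← Real.logb_div (by positivity) hε.ne']
    refine le_of_eq_of_le ?_ (Real.logb_le_logb_of_le hA (by positivity) hL)
    rw [Real.logb_rpow_eq_mul_logb_of_pos (by positivity), Real.logb_pow,
      Real.logb_self_eq_one hA, mul_one]
  have hDlog : Real.logb A D ≤ Real.logb A D / Real.logb A 2 * |Real.logb A ε| := by
    rw [div_mul_eq_mul_div, le_div_iff₀ hlog2]
    gcongr
  rw [div_mul_eq_mul_div, le_div_iff₀ hα]
  linarith [neg_le_abs (Real.logb A ε)]

end LevelChoice

section Allocation

variable {A b ε : ℝ}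

/-- The real numbers of samples that minimise the sampling cost `∑ x_ℓ (A^ℓ)^γ` subject to the
error constraint `∑ b x_ℓ^(-1/2) (A^ℓ)^(-β) = ε / 2`, where `ℓ` ranges over `1, …, L`. -/
noncomputable def optimalSamples (A β γ b ε : ℝ) (L ℓ : ℕ) : ℝ :=
  (2 * b / ε * levelSum A ((γ - 2 * β) / 3) L * (A ^ ℓ) ^ (-((β + γ) / 3))) ^ 2

theorem optimalSamples_pos (hA : 0 < A) (β γ : ℝ) (hb : 0 < b) (hε : 0 < ε) {L : ℕ} (hL : 1 ≤ L)
    (ℓ : ℕ) : 0 < optimalSamples A β γ b ε L ℓ := by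
  have := levelSum_pos hA ((γ - 2 * β) / 3) hL
  unfold optimalSamples
  positivity

theorem sum_div_sqrt_optimalSamples (hA : 0 < A) (β γ : ℝ) (hb : 0 < b) (hε : 0 < ε) {L : ℕ}
    (hL : 1 ≤ L) : ∑ ℓ ∈ Finset.Icc 1 L, b / √(optimalSamples A β γ b ε L ℓ) * (A ^ ℓ) ^ (-β)
      = ε / 2 := by
  have hT := levelSum_pos hA ((γ - 2 * β) / 3) hL
  have hterm : ∀ ℓ : ℕ, b / √(optimalSamples A β γ b ε L ℓ) * (A ^ ℓ) ^ (-β)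
      = ε / (2 * levelSum A ((γ - 2 * β) / 3) L) * (A ^ ℓ) ^ ((γ - 2 * β) / 3) := fun ℓ => by
    have hexp : (A ^ ℓ) ^ (-β) = (A ^ ℓ) ^ ((γ - 2 * β) / 3) * (A ^ ℓ) ^ (-((β + γ) / 3)) := by
      rw [← Real.rpow_add (by positivity)]
      ring_nf
    rw [optimalSamples, Real.sqrt_sq (by positivity), hexp]
    field_simp
  simp only [hterm, ← Finset.mul_sum]
  rw [← levelSum]
  field_simp

theorem sum_optimalSamples_mul (hA : 0 < A) (β γ : ℝ) (hε : 0 < ε) (L : ℕ) :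
    ∑ ℓ ∈ Finset.Icc 1 L, optimalSamples A β γ b ε L ℓ * (A ^ ℓ) ^ γ
      = 4 * b ^ 2 * (levelSum A ((γ - 2 * β) / 3) L ^ 3 * ε ^ (-2 : ℝ)) := by
  have hterm : ∀ ℓ : ℕ, optimalSamples A β γ b ε L ℓ * (A ^ ℓ) ^ γ
      = (2 * b / ε * levelSum A ((γ - 2 * β) / 3) L) ^ 2 * (A ^ ℓ) ^ ((γ - 2 * β) / 3) :=
    fun ℓ => by
    rw [optimalSamples, mul_pow, ← Real.rpow_mul_natCast (by positivity), mul_assoc,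
      ← Real.rpow_add (by positivity)]
    congr 2
    push_cast
    ring
  have hε_pow : ε ^ (-2 : ℝ) = (ε ^ 2)⁻¹ := by
    rw [Real.rpow_neg hε.le, Real.rpow_two]
  simp only [hterm, ← Finset.mul_sum]
  rw [← levelSum, hε_pow]
  field_simp
  ring

theorem exists_samples (hA : 0 < A) (β γ : ℝ) (hb : 0 < b) (hε : 0 < ε) {L : ℕ} (hL : 1 ≤ L) :
    ∃ M : ℕ → ℕ, (∀ ℓ, 1 ≤ M ℓ) ∧
      ∑ ℓ ∈ Finset.Icc 1 L, b / √(M ℓ) * (A ^ ℓ) ^ (-β) ≤ ε / 2 ∧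
      ∑ ℓ ∈ Finset.Icc 1 L, M ℓ * (A ^ ℓ) ^ γ
        ≤ 4 * b ^ 2 * (levelSum A ((γ - 2 * β) / 3) L ^ 3 * ε ^ (-2 : ℝ)) + levelSum A γ L := by
  have hpos := optimalSamples_pos hA β γ hb hε hL
  refine ⟨fun ℓ => ⌈optimalSamples A β γ b ε L ℓ⌉₊, fun ℓ => Nat.ceil_pos.2 (hpos ℓ), ?_, ?_⟩
  · rw [← sum_div_sqrt_optimalSamples hA β γ hb hε hL]
    refine Finset.sum_le_sum fun ℓ _ => ?_
    have := hpos ℓ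
    gcongr
    exact Nat.le_ceil _
  · rw [← sum_optimalSamples_mul hA β γ hε, levelSum, ← Finset.sum_add_distrib]
    refine Finset.sum_le_sum fun ℓ _ => ?_
    rw [← add_one_mul]
    gcongr
    exact (Nat.ceil_lt_add_one (hpos ℓ).le).le

end Allocation

section Complexity

variable {A α β γ D : ℝ}

/-- The part of `complexityRate` that comes from the sampling error, as opposed to the term
`ε ^ (-(γ / α))` for drawing one sample on each level. -/
noncomputable def samplingRate (A α β γ ε : ℝ) : ℝ :=
  if γ / 2 < β then ε ^ (-2 : ℝ)
  else if β = γ / 2 then ε ^ (-2 : ℝ) * |Real.logb A ε| ^ 3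
  else ε ^ (-2 - (γ - 2 * β) / α)

theorem complexityRate_eq (A α β γ ε : ℝ) :
    complexityRate A α β γ ε = ε ^ (-(γ / α)) + samplingRate A α β γ ε := by
  unfold complexityRate samplingRate
  split_ifs <;> rfl

theorem samplingRate_nonneg (A α β γ : ℝ) {ε : ℝ} (hε : 0 ≤ ε) : 0 ≤ samplingRate A α β γ ε := by
  unfold samplingRate
  split_ifs <;> positivity

theorem levelSum_pow_le_of_pos (hA : 1 < A) {θ : ℝ} (hθ : 0 < θ) (L n : ℕ) :
    levelSum A θ L ^ n ≤ (A ^ θ / (A ^ θ - 1)) ^ n * (A ^ L) ^ (n * θ) := by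
  refine (pow_le_pow_left₀ (levelSum_nonneg (by positivity) _ _)
    (levelSum_le_of_pos hA hθ L) n).trans_eq ?_
  rw [mul_pow, mul_comm (n : ℝ), Real.rpow_mul_natCast (by positivity)]

theorem exists_levelSum_pow_le_samplingRate (hA : 1 < A) (hα : 0 < α) (hD : 1 ≤ D) (β γ : ℝ) :
    ∃ W : ℝ, 0 < W ∧ ∀ ε : ℝ, 0 < ε → ε ≤ 1 / 2 → ∀ L : ℕ, (A ^ L) ^ α ≤ D / ε →
      levelSum A ((γ - 2 * β) / 3) L ^ 3 * ε ^ (-2 : ℝ) ≤ W * samplingRate A α β γ ε := by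
  unfold samplingRate
  rcases lt_trichotomy (γ / 2) β with h | h | h
  · have hθ : (γ - 2 * β) / 3 < 0 := by linarith
    have hratio : A ^ ((γ - 2 * β) / 3) < 1 := Real.rpow_lt_one_of_one_lt_of_neg hA hθ
    refine ⟨(A ^ ((γ - 2 * β) / 3) / (1 - A ^ ((γ - 2 * β) / 3))) ^ 3,
      pow_pos (div_pos (by positivity) (sub_pos.2 hratio)) 3, fun ε hε _ L _ => ?_⟩
    have := levelSum_nonneg (zero_le_one.trans hA.le) ((γ - 2 * β) / 3) L
    rw [if_pos h]
    gcongr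
    exact levelSum_le_of_neg hA hθ L
  · obtain ⟨H, hH, hL_le⟩ := exists_level_le_mul_abs_logb hA hα hD
    refine ⟨H ^ 3, by positivity, fun ε hε hε2 L hL => ?_⟩
    rw [if_neg h.not_lt, if_pos h.symm, show (γ - 2 * β) / 3 = 0 by linarith, levelSum_zero,
      mul_left_comm, ← mul_pow, mul_comm]
    gcongr
    exact hL_le ε hε hε2 L hL
  · have hθ : 0 < (γ - 2 * β) / 3 := by linarith
    have hratio : 1 < A ^ ((γ - 2 * β) / 3) := Real.one_lt_rpow hA hθ
    refine ⟨(A ^ ((γ - 2 * β) / 3) / (A ^ ((γ - 2 * β) / 3) - 1)) ^ 3 * D ^ ((γ - 2 * β) / α),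
      mul_pos (pow_pos (div_pos (by positivity) (sub_pos.2 hratio)) 3) (by positivity),
      fun ε hε _ L hL => ?_⟩
    have hsum := levelSum_pow_le_of_pos hA hθ L 3
    rw [Nat.cast_ofNat, mul_div_cancel₀ _ three_ne_zero] at hsum
    have hlevel := rpow_le_of_rpow_le_div hα (zero_le_one.trans hD) hε
      (κ := γ - 2 * β) (by linarith) (by positivity) hL
    rw [if_neg h.not_gt, if_neg h.ne, sub_eq_neg_add (-2), Real.rpow_add hε, ← mul_assoc,
      mul_assoc (_ ^ 3)]
    gcongr
    refine hsum.trans ?_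
    gcongr

theorem exists_cost_le_complexityRate (hA : 1 < A) (hα : 0 < α) (hγ : 0 < γ) (hD : 1 ≤ D)
    (β : ℝ) {k : ℝ} (hk : 0 ≤ k) : ∃ C : ℝ, 0 < C ∧ ∀ ε : ℝ, 0 < ε → ε ≤ 1 / 2 → ∀ L : ℕ,
      (A ^ L) ^ α ≤ D / ε →
        k * (levelSum A ((γ - 2 * β) / 3) L ^ 3 * ε ^ (-2 : ℝ)) + levelSum A γ L
          ≤ C * complexityRate A α β γ ε := by
  obtain ⟨W, hW, hsampling⟩ := exists_levelSum_pow_le_samplingRate hA hα hD β γ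
  have hratio : 0 < A ^ γ - 1 := sub_pos.2 (Real.one_lt_rpow hA hγ)
  set V := A ^ γ / (A ^ γ - 1) * D ^ (γ / α) with hV
  have hV0 : 0 < V := by positivity
  refine ⟨k * W + V, by positivity, fun ε hε hε2 L hL => ?_⟩
  have hone : levelSum A γ L ≤ V * ε ^ (-(γ / α)) := by
    rw [hV, mul_assoc]
    refine (levelSum_le_of_pos hA hγ L).trans ?_
    gcongr
    exact rpow_le_of_rpow_le_div hα (zero_le_one.trans hD) hε hγ.le (by positivity) hL
  have hR := samplingRate_nonneg A α β γ hε.le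
  calc k * (levelSum A ((γ - 2 * β) / 3) L ^ 3 * ε ^ (-2 : ℝ)) + levelSum A γ L
      ≤ k * (W * samplingRate A α β γ ε) + V * ε ^ (-(γ / α)) :=
        add_le_add (mul_le_mul_of_nonneg_left (hsampling ε hε hε2 L hL) hk) hone
    _ ≤ (k * W + V) * samplingRate A α β γ ε + (k * W + V) * ε ^ (-(γ / α)) := by
        rw [← mul_assoc]
        gcongr
        · exact le_add_of_nonneg_right hV0.le
        · exact le_add_of_nonneg_left (by positivity)
    _ = (k * W + V) * complexityRate A α β γ ε := by rw [complexityRate_eq]; ring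

theorem exists_parameters (hA : 1 < A) (hα : 0 < α) (β : ℝ) (hγ : 0 < γ) (a : ℝ) {b c : ℝ}
    (hb : 0 < b) (hc : 0 < c) : ∃ C : ℝ, 0 < C ∧
    ∀ ε : ℝ, 0 < ε → ε ≤ 1 / 2 → ∃ (L : ℕ) (M : ℕ → ℕ), 1 ≤ L ∧ (∀ ℓ, 1 ≤ M ℓ) ∧
      a * (A ^ L) ^ (-α) + ∑ ℓ ∈ Finset.Icc 1 L, b / √(M ℓ) * (A ^ ℓ) ^ (-β) < ε ∧
      ∑ ℓ ∈ Finset.Icc 1 L, M ℓ * (c * (A ^ ℓ) ^ γ) ≤ C * complexityRate A α β γ ε := by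
  obtain ⟨D, hD, hlevel⟩ := exists_level hA hα a
  obtain ⟨C, hC, hcost⟩ := exists_cost_le_complexityRate hA hα hγ hD β
    (by positivity : 0 ≤ 4 * b ^ 2)
  refine ⟨c * C, by positivity, fun ε hε hε2 => ?_⟩
  obtain ⟨L, hL, hbias, hLε⟩ := hlevel ε hε (by linarith)
  obtain ⟨M, hM, hsampling, hMcost⟩ := exists_samples (zero_lt_one.trans hA) β γ hb hε hL
  refine ⟨L, M, hL, hM, by linarith, ?_⟩
  simp only [mul_left_comm _ c, ← Finset.mul_sum]
  rw [mul_assoc c C]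
  gcongr
  exact hMcost.trans (hcost ε hε hε2 L hLε)

end Complexity

theorem rpow_le_max_mul_rpow {c₁ c₂ x y : ℝ} (hc₁ : 0 < c₁) (hy : 0 < y) (hxy : c₁ * y ≤ x)
    (hyx : x ≤ c₂ * y) (t : ℝ) : x ^ t ≤ max (c₁ ^ t) (c₂ ^ t) * y ^ t := by
  have hx : 0 < x := (mul_pos hc₁ hy).trans_le hxy
  have hc₂ : 0 < c₂ := pos_of_mul_pos_left (hx.trans_le hyx) hy.le
  rcases le_total 0 t with ht | ht
  · calc x ^ t ≤ (c₂ * y) ^ t := by gcongr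
      _ = c₂ ^ t * y ^ t := Real.mul_rpow hc₂.le hy.le
      _ ≤ _ := by gcongr; exact le_max_right _ _
  · calc x ^ t ≤ (c₁ * y) ^ t := Real.rpow_le_rpow_of_nonpos (by positivity) hxy ht
      _ = c₁ ^ t * y ^ t := Real.mul_rpow hc₁.le hy.le
      _ ≤ _ := by gcongr; exact le_max_left _ _

end MLMC

theorem mainTheorem7_general (q : ℝ≥0∞) [Fact (1 ≤ q)] (hq : 2 ≤ q) (hq_top : q ≠ ∞)
    (α β γ Cα Cβ Cγ A c₁ c₂ : ℝ) (hα : 0 < α) (hγ : 0 < γ)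
    (hCα : 0 < Cα) (hCβ : 0 < Cβ) (hCγ : 0 < Cγ) (hA : 1 < A) (hc₁ : 0 < c₁) :
    ∃ C : ℝ, 0 < C ∧
      ∀ (S : Type u) [MeasurableSpace S] (μ : Measure S) [SigmaFinite μ]
        (Ω : Type v) [MeasurableSpace Ω] (P : Measure Ω) [IsProbabilityMeasure P]
        (p : ℝ≥0∞) [Fact (1 ≤ p)] (_ : p ≤ q) (x : Lp ℝ p μ)
        (Xl : ℕ → Ω → Lp ℝ p μ) (_ : Xl 0 = 0) (_ : ∀ ℓ, 1 ≤ ℓ → Integrable (Xl ℓ) P)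
        (N : ℕ → ℝ) (_ : ∀ ℓ, 1 ≤ ℓ → c₁ * A ^ ℓ ≤ N ℓ ∧ N ℓ ≤ c₂ * A ^ ℓ)
        (cost : ℕ → ℝ≥0)
        (_ : ∀ ℓ, 1 ≤ ℓ → ‖x - ∫ ω, Xl ℓ ω ∂P‖ ≤ Cα * N ℓ ^ (-α))
        (_ : ∀ ℓ, 1 ≤ ℓ →
          MLMC.mixedNorm q P (fun ω => (Xl ℓ ω - ∫ ω', Xl ℓ ω' ∂P) -
            (Xl (ℓ - 1) ω - ∫ ω', Xl (ℓ - 1) ω' ∂P)) ≤ ENNReal.ofReal (Cβ * N ℓ ^ (-β)))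
        (_ : ∀ ℓ, 1 ≤ ℓ → (cost ℓ : ℝ) ≤ Cγ * N ℓ ^ γ)
        (ξ : ℕ → ℕ → Ω → Lp ℝ p μ)
        (_ : ∀ ℓ, 1 ≤ ℓ → iIndepFun (ξ ℓ) P)
        (_ : ∀ ℓ, 1 ≤ ℓ → ∀ j, IdentDistrib (ξ ℓ j) (MLMC.levelDiff Xl ℓ) P P),
      ∀ ε : ℝ, 0 < ε → ε ≤ 1 / 2 →
        ∃ (L : ℕ) (M : ℕ → ℕ), 1 ≤ L ∧ (∀ ℓ, 1 ≤ M ℓ) ∧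
          eLpNorm (fun ω => x - MLMC.estimator ξ L M ω) q P < ENNReal.ofReal ε ∧
          MLMC.totalCost cost L M ≤ C * MLMC.complexityRate A α β γ ε := by
  have : 0 < A := zero_lt_one.trans hA
  have hK : 0 < MLMC.marcinkiewiczConst q.toReal := zero_lt_one.trans_le
    (MLMC.one_le_marcinkiewiczConst (by simpa using ENNReal.toReal_mono hq_top hq))
  set B : ℝ → ℝ := fun t => max (c₁ ^ t) (c₂ ^ t)
  have hB : ∀ t, 0 < B t := fun t => lt_max_of_lt_left (by positivity)
  obtain ⟨C, hC0, hC⟩ := MLMC.exists_parameters hA hα β hγ (Cα * B (-α))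
    (mul_pos (Real.sqrt_pos.2 hK) (mul_pos hCβ (hB (-β)))) (mul_pos hCγ (hB γ))
  refine ⟨C, hC0, ?_⟩
  intro S _ μ _ Ω _ P _ p _ hpq x Xl hX0 hX N hN cost hbias hvar hcost ξ hind hident ε hε hε2
  have hX' : ∀ ℓ, Integrable (Xl ℓ) P := fun ℓ => by
    rcases ℓ.eq_zero_or_pos with rfl | hℓ
    exacts [hX0 ▸ integrable_zero _ _ _, hX ℓ hℓ]
  have hscale : ∀ ℓ, 1 ≤ ℓ → ∀ {c}, 0 < c → ∀ t, c * N ℓ ^ t ≤ c * B t * (A ^ ℓ) ^ t :=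
    fun ℓ hℓ c hc t => by
      rw [mul_assoc]
      gcongr
      exact MLMC.rpow_le_max_mul_rpow hc₁ (by positivity) (hN ℓ hℓ).1 (hN ℓ hℓ).2 t
  obtain ⟨L, M, hL, hM, herror, hMcost⟩ := hC ε hε hε2
  refine ⟨L, M, hL, hM, ?_, le_trans (Finset.sum_le_sum fun ℓ hℓ => ?_) hMcost⟩
  · refine (MLMC.eLpNorm_sub_estimator_le_ofReal hpq hq hq_top hX0 hX' hind hident
      (fun ℓ => Nat.one_le_iff_ne_zero.1 (hM ℓ)) ((hbias L hL).trans (hscale L hL hCα (-α)))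
      (fun ℓ => mul_nonneg (mul_pos hCβ (hB (-β))).le (by positivity)) fun ℓ hℓ =>
      (hvar ℓ hℓ).trans (ENNReal.ofReal_le_ofReal (hscale ℓ hℓ hCβ (-β)))).trans_lt ?_
    rw [ENNReal.ofReal_lt_ofReal_iff hε]
    convert herror using 3 with ℓ
    rw [Real.sqrt_div hK.le]
    ring
  · have hℓ1 := (Finset.mem_Icc.1 hℓ).1
    gcongr
    exact (hcost ℓ hℓ1).trans (hscale ℓ hℓ1 hCγ γ)

/-- The constant `C` depends only on `q`, the rates and the constants in the hypotheses. -/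
theorem mainTheorem7 (q : ℝ≥0∞) [Fact (1 ≤ q)] (hq : 2 ≤ q) (hq_top : q ≠ ∞)
    (α β γ Cα Cβ Cγ A c₁ c₂ : ℝ) (hα : 0 < α) (hβ : 0 < β) (hγ : 0 < γ)
    (hCα : 0 < Cα) (hCβ : 0 < Cβ) (hCγ : 0 < Cγ) (hA : 1 < A) (hc₁ : 0 < c₁) (hc₂ : 0 < c₂) :
    ∃ C : ℝ, 0 < C ∧
      ∀ (S : Type u) [MeasurableSpace S] (μ : Measure S) [SigmaFinite μ]
        (_ : MLMC.ApproxByAveraging.{u, v} μ)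
        (Ω : Type v) [MeasurableSpace Ω] (P : Measure Ω) [IsProbabilityMeasure P]
        (p : ℝ≥0∞) [Fact (1 ≤ p)] (_ : p ≤ q)
        (X : Ω → Lp ℝ p μ) (_ : MemLp X 1 P)
        -- the approximations, with the convention `X_0 = 0`
        (Xl : ℕ → Ω → Lp ℝ p μ) (_ : Xl 0 = 0)
        (_ : ∀ ℓ, 1 ≤ ℓ → MemLp (Xl ℓ) q P ∧ MLMC.MemMixed q P (Xl ℓ))
        (N : ℕ → ℝ) (_ : ∀ ℓ, 1 ≤ ℓ → c₁ * A ^ ℓ ≤ N ℓ ∧ N ℓ ≤ c₂ * A ^ ℓ)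
        (cost : ℕ → ℝ≥0)
        -- the assumptions (α), (β), (γ)
        (_ : ∀ ℓ, 1 ≤ ℓ → ‖(∫ ω, X ω ∂P) - ∫ ω, Xl ℓ ω ∂P‖ ≤ Cα * N ℓ ^ (-α))
        (_ : ∀ ℓ, 1 ≤ ℓ →
          MLMC.mixedNorm q P (fun ω => (Xl ℓ ω - ∫ ω', Xl ℓ ω' ∂P) -
            (Xl (ℓ - 1) ω - ∫ ω', Xl (ℓ - 1) ω' ∂P)) ≤ ENNReal.ofReal (Cβ * N ℓ ^ (-β)))
        (_ : ∀ ℓ, 1 ≤ ℓ → (cost ℓ : ℝ) ≤ Cγ * N ℓ ^ γ)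
        -- on each level, a sequence of independent copies of `ξ_ℓ`
        (ξ : ℕ → ℕ → Ω → Lp ℝ p μ)
        (_ : ∀ ℓ, 1 ≤ ℓ → ∀ j, MemLp (ξ ℓ j) q P ∧ MLMC.MemMixed q P (ξ ℓ j))
        (_ : ∀ ℓ, 1 ≤ ℓ → iIndepFun (ξ ℓ) P)
        (_ : ∀ ℓ, 1 ≤ ℓ → ∀ j, IdentDistrib (ξ ℓ j) (MLMC.levelDiff Xl ℓ) P P),
      ∀ ε : ℝ, 0 < ε → ε ≤ 1 / 2 →
        ∃ (L : ℕ) (M : ℕ → ℕ), 1 ≤ L ∧ (∀ ℓ ∈ Finset.Icc 1 L, 1 ≤ M ℓ) ∧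
          eLpNorm (fun ω => (∫ ω', X ω' ∂P) - MLMC.estimator ξ L M ω) q P < ENNReal.ofReal ε ∧
          MLMC.totalCost cost L M ≤ C * MLMC.complexityRate A α β γ ε := by
  obtain ⟨C, hC, h⟩ := mainTheorem7_general.{u, v} q hq hq_top α β γ Cα Cβ Cγ A c₁ c₂ hα hγ
    hCα hCβ hCγ hA hc₁
  refine ⟨C, hC, fun S _ μ _ _ Ω _ P _ p _ hpq X _ Xl hX0 hXl N hN cost hbias hvar hcost ξ _ hind
    hident ε hε hε2 => ?_⟩
  obtain ⟨L, M, hL, hM, herror, hMcost⟩ := h S μ Ω P p hpq (∫ ω, X ω ∂P) Xl hX0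
    (fun ℓ hℓ => (hXl ℓ hℓ).1.integrable Fact.out) N hN cost hbias hvar hcost ξ hind hident ε hε hε2
  exact ⟨L, M, hL, fun ℓ _ => hM ℓ, herror, hMcost⟩
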